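/- Let $G$ be a finitely generated group. A $G$-tree is a nonempty simplicial tree on which $G$ acts by automorphisms without inversions; a subgroup is elliptic in it if it has a global fixed point, and the tree is minimal if it has no proper $G$-invariant subtree. A $G$-tree $T$ dominates $T'$ if there is a $G$-equivariant map $T\to T'$ (sending vertices to vertices and each edge to the segment joining the images of its endpoints). $T$ is a refinement of $T'$ if $T'$ is obtained from $T$ by equivariantly collapsing a set of edges (equivalently, there is an equivariant, alignment-preserving surjection $T\to T'$ mapping each edge to an edge or a vertex). Two $G$-trees are compatible if they have a common refinement. Let $\mathcal E$ be a conjugation-invariant family of subgroups of $G$, and let $\mathcal H$ be a (possibly empty) family of subgroups of $G$. An $\mathcal E$-tree is a $G$-tree whose edge stabilizers all belong to $\mathcal E$ and in which every group of $\mathcal H$ is elliptic (for $\mathcal H=\emptyset$ this is the absolute case). Let $\sim$ be an admissible equivalence relation on $\mathcal E$, i.e. for all $A,B\in\mathcal E$: (1) $A\sim B$ implies $gAg^{-1}\sim gBg^{-1}$ for all $g\in G$; (2) $A\subset B$ implies $A\sim B$; (3) if $A\sim B$ and $A,B$ fix vertices $a,b$ respectively of an $\mathcal E$-tree $T$, then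 $G_e\sim A\sim B$ for every edge $e\subset[a,b]$. Assume that $\mathcal E$ is substable: whenever $G$ splits over a group $A$ relative to $\mathcal H$ (there is a $G$-tree without global fixed point, with one orbit of edges, in which $A$ is an edge stabilizer and all groups of $\mathcal H$ are elliptic) and $A$ is contained in a group of $\mathcal E$, then $A\in\mathcal E$. A subgroup is universally elliptic if it is elliptic in every $\mathcal E$-tree. Assume that $\sim$ preserves universal ellipticity: if $A,B\in\mathcal E$ and $A\sim B$, then $A$ is universally elliptic if and only if $B$ is. Let $T_J$ be a JSJ tree over $\mathcal E$, i.e. an $\mathcal E$-tree whose edge stabilizers are universally elliptic and which dominates every $\mathcal E$-tree with universally elliptic edge stabilizers. Let $T_c$ be its tree of cylinders: the cylinders of $T_J$ are the equivalence classes of edges for the relation $G_e\sim G_{e'}$, and $T_c$ is the bipartite graph whose vertex set is the disjoint union of the set $V_0$ of vertices of $T_J$ belonging to at least two distinct cylinders and the set $V_1$ of cylinders, a vertex $x\in V_0$ being joined to a cylinder $Y$ if and only if $x$ belongs to $Y$. (If $T_J$ is a single point, $T_c$ is by convention a point.) Then $T_c$ is a $G$-tree, and $T_c$ is compatible with every minimal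 $\mathcal E$-tree. -/

import Mathlib

open scoped Pointwise

universe u

namespace Cylinders

/-- The action of `G` on unordered pairs (in particular on non-oriented edges) induced by an
action on points. -/
instance sym2MulAction {G V : Type u} [Group G] [MulAction G V] : MulAction G (Sym2 V) where
  smul g := Sym2.map (fun x => g • x)
  one_smul e := by
    change Sym2.map (fun x => (1 : G) • x) e = e
    simp
  mul_smul g h e := by
    change Sym2.map (fun x => (g * h) • x) e =
      Sym2.map (fun x => g • x) (Sym2.map (fun x => h • x) e)
    rw [Sym2.map_map]
    congr 1
    funext x
    exact mul_smul g h x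

theorem mem_smul_sym2 {G V : Type u} [Group G] [MulAction G V] (g : G) {x : V} {e : Sym2 V}
    (h : x ∈ e) : g • x ∈ g • e :=
  Sym2.mem_map.2 ⟨x, h, rfl⟩

/-- A graph with an action of `G` by graph automorphisms. -/
structure GGraph (G : Type u) [Group G] where
  /-- the vertices -/
  V : Type u
  /-- the action of `G` on the vertices -/
  act : MulAction G V
  /-- the underlying graph -/
  graph : SimpleGraph V
  smul_adj : ∀ (g : G) (x y : V), graph.Adj x y → graph.Adj (g • x) (g • y)

instance {G : Type u} [Group G] (T : GGraph G) : MulAction G T.V := T.act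

namespace GGraph

variable {G : Type u} [Group G]

/-- A `G`-tree: a (nonempty) simplicial tree on which `G` acts without inversions. -/
structure IsGTree (T : GGraph G) : Prop where
  isTree : T.graph.IsTree
  no_inversion : ∀ (g : G) (x y : T.V), T.graph.Adj x y → ¬ (g • x = y ∧ g • y = x)

/-- The set of non-oriented edges. -/
def edges (T : GGraph G) : Set (Sym2 T.V) := T.graph.edgeSet

theorem smul_mem_edges (T : GGraph G) (g : G) {e : Sym2 T.V} (he : e ∈ T.edges) :
    g • e ∈ T.edges := by
  induction e using Sym2.ind with
  | _ x y => exact T.smul_adj g x y he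

/-- The stabilizer of an edge. -/
def edgeStab (T : GGraph G) (e : Sym2 T.V) : Subgroup G := MulAction.stabilizer G e

/-- The subgroup `A` fixes the vertex `v`. -/
def Fixes (T : GGraph G) (A : Subgroup G) (v : T.V) : Prop := ∀ g ∈ A, g • v = v

/-- The subgroup `A` is elliptic: it has a global fixed point (equivalently, since there are no
inversions, it fixes a vertex). -/
def Elliptic (T : GGraph G) (A : Subgroup G) : Prop := ∃ v : T.V, T.Fixes A v

/-- The edge `e` is contained in the segment `[a, b]`. -/
def EdgeInSegment (T : GGraph G) (e : Sym2 T.V) (a b : T.V) : Prop :=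
  ∃ p : T.graph.Walk a b, p.IsPath ∧ e ∈ p.edges

/-- The vertex `x` belongs to the segment `[a, b]`. -/
def VertexInSegment (T : GGraph G) (x a b : T.V) : Prop :=
  ∃ p : T.graph.Walk a b, p.IsPath ∧ x ∈ p.support

/-- A `G`-tree is minimal if it has no proper `G`-invariant subtree. -/
def IsMinimal (T : GGraph G) : Prop :=
  ∀ S : Set T.V, (T.graph.induce S).Connected → (∀ g : G, ∀ x ∈ S, g • x ∈ S) → S = Set.univ

/-- `T` dominates `T'`: there is an equivariant map from `T` to `T'` (sending vertices to
vertices; it extends to edges by sending an edge to the segment joining the images of its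
endpoints). -/
def Dominates (T T' : GGraph G) : Prop :=
  ∃ f : T.V → T'.V, ∀ (g : G) (x : T.V), f (g • x) = g • f x

/-- `f` is a collapse map: an equivariant, alignment-preserving map onto `T'` which sends every
edge to an edge or to a vertex. -/
structure IsCollapseMap (T T' : GGraph G) (f : T.V → T'.V) : Prop where
  equivariant : ∀ (g : G) (x : T.V), f (g • x) = g • f x
  surjective : Function.Surjective f
  cellular : ∀ x y : T.V, T.graph.Adj x y → f x = f y ∨ T'.graph.Adj (f x) (f y)
  alignment : ∀ x a b : T.V, T.VertexInSegment x a b → T'.VertexInSegment (f x) (f a) (f b)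

/-- `T` is a refinement of `T'`. -/
def Refines (T T' : GGraph G) : Prop := ∃ f : T.V → T'.V, IsCollapseMap T T' f

/-- Two `G`-trees are compatible if they have a common refinement. -/
def Compatible (T T' : GGraph G) : Prop :=
  ∃ R : GGraph G, R.IsGTree ∧ R.Refines T ∧ R.Refines T'

/-- An `𝓔`-tree relative to the family `𝓗`: a `G`-tree whose edge stabilizers belong to `𝓔` and
in which every group of `𝓗` is elliptic. -/
structure IsETree (𝓔 𝓗 : Set (Subgroup G)) (T : GGraph G) : Prop where
  isGTree : T.IsGTree
  edgeStab_mem : ∀ e ∈ T.edges, T.edgeStab e ∈ 𝓔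
  elliptic : ∀ H ∈ 𝓗, T.Elliptic H

end GGraph

section Families

variable {G : Type u} [Group G]

/-- The conjugate `g A g⁻¹`. -/
def conj (g : G) (A : Subgroup G) : Subgroup G := A.map (MulAut.conj g).toMonoidHom

/-- `r` (considered on `𝓔` only) is an admissible equivalence relation on `𝓔`, relative to `𝓗`. -/
structure IsAdmissible (𝓔 𝓗 : Set (Subgroup G)) (r : Subgroup G → Subgroup G → Prop) : Prop where
  refl : ∀ A ∈ 𝓔, r A A
  symm : ∀ A ∈ 𝓔, ∀ B ∈ 𝓔, r A B → r B A
  trans : ∀ A ∈ 𝓔, ∀ B ∈ 𝓔, ∀ C ∈ 𝓔, r A B → r B C → r A C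
  conj : ∀ A ∈ 𝓔, ∀ B ∈ 𝓔, r A B → ∀ g : G, r (conj g A) (conj g B)
  incl : ∀ A ∈ 𝓔, ∀ B ∈ 𝓔, A ≤ B → r A B
  segment : ∀ T : GGraph G, T.IsETree 𝓔 𝓗 → ∀ A ∈ 𝓔, ∀ B ∈ 𝓔, r A B →
    ∀ a b : T.V, T.Fixes A a → T.Fixes B b →
      ∀ e, T.EdgeInSegment e a b → r (T.edgeStab e) A ∧ r (T.edgeStab e) B

/-- `G` splits over `A` relative to `𝓗`: there is a one-edge splitting, that is, a `G`-tree
without global fixed point, with exactly one orbit of edges, in which `A` is the stabilizer of an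
edge and every group of `𝓗` is elliptic. -/
def SplitsOver (𝓗 : Set (Subgroup G)) (A : Subgroup G) : Prop :=
  ∃ T : GGraph G, T.IsGTree ∧ (∀ H ∈ 𝓗, T.Elliptic H) ∧ ¬ T.Elliptic ⊤ ∧
    ∃ e ∈ T.edges, T.edgeStab e = A ∧ ∀ e' ∈ T.edges, ∃ g : G, g • e = e'

/-- `𝓔` is substable (relative to `𝓗`). -/
def IsSubstable (𝓔 𝓗 : Set (Subgroup G)) : Prop :=
  ∀ A : Subgroup G, SplitsOver 𝓗 A → ∀ B ∈ 𝓔, A ≤ B → A ∈ 𝓔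

/-- A subgroup is universally elliptic if it is elliptic in every `𝓔`-tree (relative to `𝓗`). -/
def UniversallyElliptic (𝓔 𝓗 : Set (Subgroup G)) (A : Subgroup G) : Prop :=
  ∀ T : GGraph G, T.IsETree 𝓔 𝓗 → T.Elliptic A

/-- `r` preserves universal ellipticity. -/
def PreservesUniversalEllipticity (𝓔 𝓗 : Set (Subgroup G))
    (r : Subgroup G → Subgroup G → Prop) : Prop :=
  ∀ A ∈ 𝓔, ∀ B ∈ 𝓔, r A B → (UniversallyElliptic 𝓔 𝓗 A ↔ UniversallyElliptic 𝓔 𝓗 B)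

/-- A universally elliptic `𝓔`-tree: all its edge stabilizers are universally elliptic. -/
structure IsUniversallyEllipticTree (𝓔 𝓗 : Set (Subgroup G)) (T : GGraph G) : Prop where
  isETree : T.IsETree 𝓔 𝓗
  edgeStab_ue : ∀ e ∈ T.edges, UniversallyElliptic 𝓔 𝓗 (T.edgeStab e)

/-- A JSJ tree over `𝓔` (relative to `𝓗`): a universally elliptic `𝓔`-tree which dominates every
universally elliptic `𝓔`-tree. -/
structure IsJSJTree (𝓔 𝓗 : Set (Subgroup G)) (T : GGraph G) : Prop where
  isUE : IsUniversallyEllipticTree 𝓔 𝓗 T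
  maximal : ∀ T' : GGraph G, IsUniversallyEllipticTree 𝓔 𝓗 T' → T.Dominates T'

end Families

namespace GGraph

variable {G : Type u} [Group G]

/-- The cylinder of the edge `e`: all edges whose stabilizer is equivalent to that of `e`. -/
def cylinder (T : GGraph G) (r : Subgroup G → Subgroup G → Prop) (e : Sym2 T.V) :
    Set (Sym2 T.V) :=
  {e' | e' ∈ T.edges ∧ r (T.edgeStab e) (T.edgeStab e')}

/-- The cylinders of `T`, as sets of edges. -/
def IsCylinder (T : GGraph G) (r : Subgroup G → Subgroup G → Prop) (Y : Set (Sym2 T.V)) : Prop :=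
  ∃ e ∈ T.edges, Y = T.cylinder r e

/-- The vertex `x` belongs to `Y`, viewed as the union of its edges. -/
def MemCylinder (T : GGraph G) (x : T.V) (Y : Set (Sym2 T.V)) : Prop := ∃ e ∈ Y, x ∈ e

theorem memCylinder_smul (T : GGraph G) (g : G) {x : T.V} {Y : Set (Sym2 T.V)}
    (h : T.MemCylinder x Y) : T.MemCylinder (g • x) (g • Y) := by
  obtain ⟨e, he, hx⟩ := h
  exact ⟨g • e, Set.smul_mem_smul_set he, mem_smul_sym2 g hx⟩

theorem edgeStab_smul (T : GGraph G) (g : G) (e : Sym2 T.V) :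
    T.edgeStab (g • e) = conj g (T.edgeStab e) :=
  MulAction.stabilizer_smul_eq_stabilizer_map_conj g e

section TreeOfCylinders

variable {𝓔 𝓗 : Set (Subgroup G)} {r : Subgroup G → Subgroup G → Prop}

theorem smul_cylinder_subset (hr : IsAdmissible 𝓔 𝓗 r) {T : GGraph G} (hT : T.IsETree 𝓔 𝓗)
    (g : G) {e : Sym2 T.V} (he : e ∈ T.edges) :
    g • T.cylinder r e ⊆ T.cylinder r (g • e) := by
  rintro _ ⟨e', ⟨he', hre'⟩, rfl⟩
  refine ⟨T.smul_mem_edges g he', ?_⟩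
  change r (T.edgeStab (g • e)) (T.edgeStab (g • e'))
  rw [edgeStab_smul, edgeStab_smul]
  exact hr.conj _ (hT.edgeStab_mem e he) _ (hT.edgeStab_mem e' he') hre' g

theorem smul_cylinder (hr : IsAdmissible 𝓔 𝓗 r) {T : GGraph G} (hT : T.IsETree 𝓔 𝓗)
    (g : G) {e : Sym2 T.V} (he : e ∈ T.edges) :
    g • T.cylinder r e = T.cylinder r (g • e) := by
  refine Set.Subset.antisymm (smul_cylinder_subset hr hT g he) ?_
  have h := smul_cylinder_subset hr hT g⁻¹ (T.smul_mem_edges g he)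
  rw [inv_smul_smul] at h
  intro e' he'
  exact Set.mem_smul_set_iff_inv_smul_mem.2 (h (Set.smul_mem_smul_set he'))

theorem isCylinder_smul (hr : IsAdmissible 𝓔 𝓗 r) {T : GGraph G} (hT : T.IsETree 𝓔 𝓗)
    (g : G) {Y : Set (Sym2 T.V)} (hY : T.IsCylinder r Y) : T.IsCylinder r (g • Y) := by
  obtain ⟨e, he, rfl⟩ := hY
  exact ⟨g • e, T.smul_mem_edges g he, smul_cylinder hr hT g he⟩

/-- `V₀(T_c)`: the vertices of `T` belonging to (at least) two distinct cylinders. By convention,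
if `T` is reduced to a point, then this point is also retained (so that the tree of cylinders of a
point is a point, and not the empty graph). -/
def V₀ (hr : IsAdmissible 𝓔 𝓗 r) {T : GGraph G} (hT : T.IsETree 𝓔 𝓗) :
    SubMulAction G T.V where
  carrier := {x | (∃ Y Y' : Set (Sym2 T.V), T.IsCylinder r Y ∧ T.IsCylinder r Y' ∧ Y ≠ Y' ∧
      T.MemCylinder x Y ∧ T.MemCylinder x Y') ∨ T.edges = ∅}
  smul_mem' := by
    rintro g x (⟨Y, Y', hY, hY', hne, hx, hx'⟩ | h)
    · exact Or.inl ⟨g • Y, g • Y', isCylinder_smul hr hT g hY, isCylinder_smul hr hT g hY',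
        fun h => hne (smul_left_cancel g h), T.memCylinder_smul g hx, T.memCylinder_smul g hx'⟩
    · exact Or.inr h

/-- `V₁(T_c)`: the cylinders of `T`. -/
def V₁ (hr : IsAdmissible 𝓔 𝓗 r) {T : GGraph G} (hT : T.IsETree 𝓔 𝓗) :
    SubMulAction G (Set (Sym2 T.V)) where
  carrier := {Y | T.IsCylinder r Y}
  smul_mem' g _ hY := isCylinder_smul hr hT g hY

/-- The tree of cylinders `T_c`: the bipartite graph with vertex set `V₀ ⊔ V₁`, in which
`x ∈ V₀` is joined to `Y ∈ V₁` if and only if the vertex `x` of `T` belongs to `Y`. -/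
def treeOfCylinders (hr : IsAdmissible 𝓔 𝓗 r) {T : GGraph G} (hT : T.IsETree 𝓔 𝓗) :
    GGraph G where
  V := V₀ hr hT ⊕ V₁ hr hT
  act :=
    { smul := fun g z => Sum.map (fun x => g • x) (fun Y => g • Y) z
      one_smul := by
        rintro (x | Y)
        · exact congrArg Sum.inl (one_smul G x)
        · exact congrArg Sum.inr (one_smul G Y)
      mul_smul := by
        rintro g h (x | Y)
        · exact congrArg Sum.inl (mul_smul g h x)
        · exact congrArg Sum.inr (mul_smul g h Y) }
  graph :=
    { Adj := fun z z' =>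
        match z, z' with
        | Sum.inl x, Sum.inr Y => T.MemCylinder x.1 Y.1
        | Sum.inr Y, Sum.inl x => T.MemCylinder x.1 Y.1
        | _, _ => False
      symm := ⟨by rintro (x | Y) (x' | Y') h <;> exact h⟩
      loopless := ⟨by rintro (x | Y) h <;> exact h⟩ }
  smul_adj := by
    rintro g (x | Y) (x' | Y') h
    · exact h
    · exact T.memCylinder_smul g h
    · exact T.memCylinder_smul g h
    · exact h

end TreeOfCylinders

end GGraph

end Cylinders

/-! The tree `T` is decomposed into subtrees indexed by the incidence tree of all vertices and all
cylinders of the JSJ tree `J`. If the subtrees cover the edges of `T`, pairwise share no edge, and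
meet whenever their indices are adjacent, gluing them along the indexing tree gives a common
refinement of that tree and `T` (`exists_blowup_refining`). The incidence tree collapses to `T_c`: a
vertex of `J` lying in a single cylinder is absorbed by it (`fullTreeOfCylinders_refines`).

To a cylinder corresponds the set of vertices of `T` fixed by some group of `𝓔` in its equivalence
class (`cylinderTrace`). Admissibility makes it convex and puts the stabilizers of its edges in the
class; they are universally elliptic, since the relation preserves this property.

To a vertex `p` of `J` corresponds a subtree `F p` without universally elliptic edges
(`exists_vertex_family`). Collapse the edges of `T` that are not universally elliptic. By maximality
`J` maps to the result, and the fibres in `T` over the image points serve to blow up the vertices of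
`J`; attaching points exist because edge stabilizers of `J` are elliptic in `T`. Edge stabilizers of
the blow-up are contained in groups of `𝓔`. Finite generation provides a minimal subtree `M`, and
there substability puts the edge stabilizers in `𝓔`, so admissibility applies to `M`. If an edge of
`T` lifted to fibres of `M` over two different vertices, the stabilizers of the lifts would be
equivalent, hence equivalent to that of an edge of `J` in between, and the edge of `T` would be
universally elliptic. So the `F p` share no edge.

Finally, minimality of `T` forces each of its edges to be crossed by the image of an edge of the
blow-up. This is either a fibre edge, and then the edge of `T` lies in some `F p`, or an edge of
`J`, whose stabilizer then fixes the edge of `T` and places it in the trace of a cylinder. -/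

namespace Cylinders

/-! ### Cuts, convex sets and projections in trees -/

section Graph

variable {V W : Type u} {Γ : SimpleGraph V} {Δ : SimpleGraph W}

/-- `S` is one of the two sides of the edge `xy`, the one containing `x`. -/
structure IsCut (Γ : SimpleGraph V) (x y : V) (S : Set V) : Prop where
  left : x ∈ S
  right : y ∉ S
  eq : ∀ u v, Γ.Adj u v → u ∈ S → v ∉ S → u = x ∧ v = y

theorem IsCut.compl {x y : V} {S : Set V} (h : IsCut Γ x y S) : IsCut Γ y x Sᶜ :=
  ⟨h.right, fun h' => h' h.left, fun u v huv hu hv =>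
    (h.eq v u huv.symm (not_not.1 hv) hu).symm⟩

/-- A set of vertices is convex if it contains every path joining two of its points. -/
def IsConvex (Γ : SimpleGraph V) (C : Set V) : Prop :=
  ∀ a ∈ C, ∀ b ∈ C, ∀ p : Γ.Walk a b, p.IsPath → ∀ x ∈ p.support, x ∈ C

theorem IsConvex.inter {C D : Set V} (hC : IsConvex Γ C) (hD : IsConvex Γ D) :
    IsConvex Γ (C ∩ D) :=
  fun a ha b hb p hp x hx => ⟨hC a ha.1 b hb.1 p hp x hx, hD a ha.2 b hb.2 p hp x hx⟩

/-- A walk avoiding the edge `xy` can never leave the side of `x`, so every edge is a bridge. -/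
theorem isTree_of_cuts (hc : Γ.Connected)
    (h : ∀ x y, Γ.Adj x y → ∃ S, IsCut Γ x y S) : Γ.IsTree := by
  refine ⟨hc, SimpleGraph.isAcyclic_iff_forall_adj_isBridge.2 fun x y hxy => ?_⟩
  obtain ⟨S, hS⟩ := h x y hxy
  rw [SimpleGraph.isBridge_iff]
  rintro ⟨p⟩
  obtain ⟨d, -, hd, hd'⟩ := p.exists_boundary_dart S hS.left hS.right
  have hadj := d.adj
  rw [SimpleGraph.deleteEdges_adj] at hadj
  obtain ⟨h1, h2⟩ := hS.eq _ _ hadj.1 hd hd'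
  exact hadj.2 (by rw [h1, h2]; rfl)

theorem exists_cut (hΓ : Γ.IsAcyclic) {x y : V} (hxy : Γ.Adj x y) : ∃ S, IsCut Γ x y S := by
  have hb := SimpleGraph.isAcyclic_iff_forall_adj_isBridge.1 hΓ hxy
  rw [SimpleGraph.isBridge_iff] at hb
  refine ⟨{z | (Γ.deleteEdges {s(x, y)}).Reachable x z}, SimpleGraph.Reachable.refl _, hb, ?_⟩
  intro u v huv hu hv
  by_contra hne
  by_cases h : s(u, v) = s(x, y)
  · rcases Sym2.eq_iff.1 h with h | h
    · exact hne h
    · exact hb (h.1 ▸ hu)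
  · refine hv (SimpleGraph.Reachable.trans hu (SimpleGraph.Adj.reachable ?_))
    rw [SimpleGraph.deleteEdges_adj]
    exact ⟨huv, h⟩

/-- A path leaving the side and coming back would cross the edge `xy` twice. -/
theorem IsCut.isConvex {x y : V} {S : Set V} (h : IsCut Γ x y S) : IsConvex Γ S := by
  classical
  intro a ha b hb p hp z hz
  by_contra hzS
  obtain ⟨d, hd, h1, h2⟩ := (p.takeUntil z hz).exists_boundary_dart S ha hzS
  obtain ⟨d', hd', h1', h2'⟩ :=
    (p.dropUntil z hz).reverse.exists_boundary_dart S hb hzS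
  obtain ⟨e1, e2⟩ := h.eq _ _ d.adj h1 h2
  obtain ⟨e1', e2'⟩ := h.eq _ _ d'.adj h1' h2'
  have hnd := hp.isTrail.edges_nodup
  rw [← p.take_spec hz, SimpleGraph.Walk.edges_append] at hnd
  refine (List.nodup_append.1 hnd).2.2 s(x, y) ?_ s(x, y) ?_ rfl
  · have := List.mem_map_of_mem (f := SimpleGraph.Dart.edge) hd
    rwa [show d.edge = s(x, y) by rw [← e1, ← e2]; rfl] at this
  · have := List.mem_map_of_mem (f := SimpleGraph.Dart.edge) hd'
    rw [show d'.edge = s(x, y) by rw [← e1', ← e2']; rfl] at this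
    have h3 : s(x, y) ∈ (p.dropUntil z hz).reverse.edges := this
    rwa [SimpleGraph.Walk.edges_reverse, List.mem_reverse] at h3

theorem path_unique (hΓ : Γ.IsAcyclic) {a b : V} {p q : Γ.Walk a b} (hp : p.IsPath)
    (hq : q.IsPath) : p = q :=
  congrArg Subtype.val ((hΓ.subsingleton_path a b).elim ⟨p, hp⟩ ⟨q, hq⟩)

theorem isConvex_of_walks (hΓ : Γ.IsAcyclic) {C : Set V}
    (h : ∀ a ∈ C, ∀ b ∈ C, ∃ w : Γ.Walk a b, ∀ x ∈ w.support, x ∈ C) : IsConvex Γ C := by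
  classical
  intro a ha b hb p hp x hx
  obtain ⟨w, hw⟩ := h a ha b hb
  rw [path_unique hΓ hp w.bypass_isPath] at hx
  exact hw x (w.support_bypass_subset_support hx)

theorem exists_path (hΓ : Γ.Connected) (a b : V) : ∃ p : Γ.Walk a b, p.IsPath :=
  (hΓ a b).exists_isPath

theorem IsConvex.exists_walk (hΓ : Γ.Connected) {C : Set V} (hC : IsConvex Γ C) {a b : V}
    (ha : a ∈ C) (hb : b ∈ C) : ∃ w : Γ.Walk a b, ∀ x ∈ w.support, x ∈ C := by
  obtain ⟨p, hp⟩ := exists_path hΓ a b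
  exact ⟨p, hC a ha b hb p hp⟩

theorem IsConvex.induce_connected (hΓ : Γ.Connected) {C : Set V} (hC : IsConvex Γ C)
    (hne : C.Nonempty) : (Γ.induce C).Connected := by
  have : Nonempty C := hne.to_subtype
  refine ⟨fun a b => ?_⟩
  obtain ⟨w, hw⟩ := hC.exists_walk hΓ a.2 b.2
  exact ⟨w.induce C hw⟩

theorem isConvex_of_induce_connected (hΓ : Γ.IsAcyclic) {C : Set V}
    (hC : (Γ.induce C).Preconnected) : IsConvex Γ C := by
  refine isConvex_of_walks hΓ fun a ha b hb => ?_
  obtain ⟨w⟩ := hC ⟨a, ha⟩ ⟨b, hb⟩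
  let f : Γ.induce C →g Γ := ⟨Subtype.val, fun h => h⟩
  refine ⟨w.map f, fun x hx => ?_⟩
  rw [SimpleGraph.Walk.support_map, List.mem_map] at hx
  obtain ⟨z, -, rfl⟩ := hx
  exact z.2

/-- The convex hull of a set of vertices. -/
def hull (Γ : SimpleGraph V) (A : Set V) : Set V := {v | ∀ C, IsConvex Γ C → A ⊆ C → v ∈ C}

theorem subset_hull (A : Set V) : A ⊆ hull Γ A := fun _ ha _ _ h => h ha

theorem isConvex_hull (A : Set V) : IsConvex Γ (hull Γ A) :=
  fun a ha b hb p hp x hx C hC hA => hC a (ha C hC hA) b (hb C hC hA) p hp x hx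

/-- If `A` lay on one side of the cut, that side would be a convex set containing `A` and missing an
endpoint of the edge. -/
theorem IsCut.exists_of_mem_hull {x y : V} {S A : Set V} (h : IsCut Γ x y S)
    (hx : x ∈ hull Γ A) (hy : y ∈ hull Γ A) : (∃ a ∈ A, a ∈ S) ∧ ∃ b ∈ A, b ∉ S := by
  constructor
  · by_contra! hA
    exact hx _ h.compl.isConvex hA h.left
  · by_contra! hA
    exact h.right (hy _ h.isConvex hA)

/-- The map `π` is the projection onto the convex set `C`. -/
structure IsProjection (Γ : SimpleGraph V) (C : Set V) (π : V → V) : Prop where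
  mem : ∀ v, π v ∈ C
  eq_self : ∀ v ∈ C, π v = v
  eq_of_adj : ∀ u v, Γ.Adj u v → ¬ (u ∈ C ∧ v ∈ C) → π u = π v

theorem exists_projection (hΓ : Γ.IsTree) {C : Set V} (hC : IsConvex Γ C) (hne : C.Nonempty) :
    ∃ π, IsProjection Γ C π := by
  -- With the edges inside `C` deleted, each component meets `C` in exactly one vertex, which is the
  -- projection of the whole component.
  let H : SimpleGraph V :=
    { Adj := fun u v => Γ.Adj u v ∧ ¬ (u ∈ C ∧ v ∈ C)
      symm := ⟨fun u v h => ⟨h.1.symm, fun h' => h.2 h'.symm⟩⟩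
      loopless := ⟨fun u h => h.1.ne rfl⟩ }
  have hle : H ≤ Γ := fun u v h => h.1
  have hex : ∀ v, ∃ c ∈ C, H.Reachable v c := by
    obtain ⟨c, hc⟩ := hne
    intro v
    obtain ⟨p⟩ := hΓ.connected v c
    induction p with
    | nil => exact ⟨_, hc, SimpleGraph.Reachable.refl _⟩
    | @cons a b _ hab p ih =>
      by_cases ha : a ∈ C
      · exact ⟨a, ha, SimpleGraph.Reachable.refl _⟩
      · obtain ⟨c', hc', h⟩ := ih hc
        have hab' : H.Adj a b := ⟨hab, fun h => ha h.1⟩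
        exact ⟨c', hc', hab'.reachable.trans h⟩
  have huniq : ∀ c ∈ C, ∀ c' ∈ C, H.Reachable c c' → c = c' := by
    intro c hc c' hc' h
    obtain ⟨p, hp⟩ := h.exists_isPath
    -- Convexity keeps the path inside `C`, where `H` has no edge, so the path is trivial.
    have hp' : (p.mapLe hle).IsPath := hp.mapLe hle
    have hsup := hC c hc c' hc' _ hp'
    cases p with
    | nil => rfl
    | @cons _ b _ hab p =>
      exact absurd ⟨hc, hsup b (by simp)⟩ hab.2
  choose π hπ hπ' using hex
  refine ⟨π, hπ, fun v hv => (huniq _ hv _ (hπ v) (hπ' v)).symm, fun u v huv hn => ?_⟩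
  have hadj : H.Adj u v := ⟨huv, hn⟩
  exact huniq _ (hπ u) _ (hπ v) ((hπ' u).symm.trans (hadj.reachable.trans (hπ' v)))

theorem IsProjection.unique (hΓ : Γ.Connected) {C : Set V} {π π' : V → V}
    (h : IsProjection Γ C π) (h' : IsProjection Γ C π') (v : V) : π v = π' v := by
  obtain ⟨c, hc⟩ : ∃ c, c ∈ C := ⟨_, h.mem v⟩
  obtain ⟨p⟩ := hΓ v c
  induction p with
  | nil => rw [h.eq_self _ hc, h'.eq_self _ hc]
  | @cons a b _ hab p ih =>
    by_cases hb : a ∈ C ∧ b ∈ C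
    · rw [h.eq_self _ hb.1, h'.eq_self _ hb.1]
    · rw [h.eq_of_adj a b hab hb, h'.eq_of_adj a b hab hb, ih hc]

/-- The image of a walk under a graph homomorphism. -/
theorem exists_map_walk (f : V → W) (hf : ∀ x y, Γ.Adj x y → Δ.Adj (f x) (f y)) {a b : V}
    (p : Γ.Walk a b) {a' b' : W} (ha : f a = a') (hb : f b = b') :
    ∃ q : Δ.Walk a' b', q.support = p.support.map f := by
  subst ha hb
  let F : Γ →g Δ := ⟨f, fun {x y} h => hf x y h⟩
  exact ⟨p.map F, SimpleGraph.Walk.support_map F p⟩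

theorem isPath_of_support {a b : V} {a' b' : W} {p : Γ.Walk a b} (hp : p.IsPath)
    {q : Δ.Walk a' b'} {f : V → W} (hf : Function.Injective f)
    (h : q.support = p.support.map f) : q.IsPath := by
  rw [SimpleGraph.Walk.isPath_def] at hp ⊢
  rw [h]
  exact hp.map hf

/-- The vertices that lie on a path are endpoints of edges of the path, unless the path is
trivial. -/
theorem exists_edge_of_mem_support {a b : V} (p : Γ.Walk a b) {x : V} (hx : x ∈ p.support) :
    x = a ∨ ∃ e ∈ p.edges, x ∈ e := by
  induction p with
  | nil => left; simpa using hx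
  | @cons a c _ h p ih =>
    rcases List.mem_cons.1 (SimpleGraph.Walk.support_cons h p ▸ hx) with rfl | hx
    · exact Or.inl rfl
    · right
      rcases ih hx with rfl | ⟨e, he, hxe⟩
      · exact ⟨s(a, x), by simp, by simp⟩
      · exact ⟨e, by simp [he], hxe⟩

/-- The image of a trail under a map which sends edges to edges or vertices, and is injective on
the edges that are not collapsed. -/
theorem exists_image_trail (f : V → W) (hcell : ∀ x y, Γ.Adj x y → f x = f y ∨ Δ.Adj (f x) (f y))
    (hinj : ∀ x y x' y', Γ.Adj x y → Γ.Adj x' y' → f x ≠ f y →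
      s(f x, f y) = s(f x', f y') → s(x, y) = s(x', y'))
    {a b : V} (p : Γ.Walk a b) (hp : p.IsTrail) :
    ∃ q : Δ.Walk (f a) (f b), q.IsTrail ∧ (∀ x ∈ p.support, f x ∈ q.support) ∧
      ∀ e' ∈ q.edges, ∃ e ∈ p.edges, e.map f = e' := by
  induction p with
  | nil => exact ⟨SimpleGraph.Walk.nil, by simp, by simp, by simp⟩
  | @cons a c b h p ih =>
    rw [SimpleGraph.Walk.isTrail_cons] at hp
    obtain ⟨q, hq, hsup, hed⟩ := ih hp.1
    by_cases hac : f a = f c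
    · refine ⟨q.copy hac.symm rfl, by simpa using hq, ?_, ?_⟩
      · intro x hx
        rw [SimpleGraph.Walk.support_copy]
        rcases List.mem_cons.1 (SimpleGraph.Walk.support_cons h p ▸ hx) with rfl | hx
        · rw [hac]; exact q.start_mem_support
        · exact hsup x hx
      · intro e' he'
        rw [SimpleGraph.Walk.edges_copy] at he'
        obtain ⟨e, he, rfl⟩ := hed e' he'
        exact ⟨e, by simp [he], rfl⟩
    · have hadj := (hcell a c h).resolve_left hac
      refine ⟨SimpleGraph.Walk.cons hadj q, ?_, ?_, ?_⟩
      · rw [SimpleGraph.Walk.isTrail_cons]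
        -- A repeated image edge comes from an edge of the tail with the same image, which by
        -- injectivity is the first edge again.
        refine ⟨hq, fun hmem => hp.2 ?_⟩
        obtain ⟨e, he, hee⟩ := hed _ hmem
        induction e using Sym2.ind with
        | _ x y =>
          rw [hinj a c x y h (p.adj_of_mem_edges he) hac hee.symm]
          exact he
      · intro x hx
        rcases List.mem_cons.1 (SimpleGraph.Walk.support_cons h p ▸ hx) with rfl | hx
        · simp
        · simp [hsup x hx]
      · intro e' he'
        rcases List.mem_cons.1 (SimpleGraph.Walk.edges_cons hadj q ▸ he') with rfl | he'
        · exact ⟨s(a, c), by simp, rfl⟩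
        · obtain ⟨e, he, rfl⟩ := hed e' he'
          exact ⟨e, by simp [he], rfl⟩

end Graph

/-! ### Stabilizers, fixed points and invariant subtrees -/

namespace GGraph

variable {G : Type u} [Group G]

theorem smul_mk {T : GGraph G} (g : G) (x y : T.V) : g • s(x, y) = s(g • x, g • y) := rfl

theorem mem_edgeStab_of_fixed {T : GGraph G} {g : G} {x y : T.V} (hx : g • x = x)
    (hy : g • y = y) : g ∈ T.edgeStab s(x, y) := by
  change g • s(x, y) = s(x, y)
  rw [smul_mk, hx, hy]

theorem IsGTree.mem_edgeStab {T : GGraph G} (hT : T.IsGTree) {g : G} {x y : T.V}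
    (hxy : T.graph.Adj x y) : g ∈ T.edgeStab s(x, y) ↔ g • x = x ∧ g • y = y := by
  refine ⟨fun h => ?_, fun h => mem_edgeStab_of_fixed h.1 h.2⟩
  have h' : s(g • x, g • y) = s(x, y) := h
  rcases Sym2.eq_iff.1 h' with h | h
  · exact h
  · exact absurd h (hT.no_inversion g x y hxy)

theorem IsGTree.fixes_of_mem {T : GGraph G} (hT : T.IsGTree) {e : Sym2 T.V} (he : e ∈ T.edges)
    {x : T.V} (hx : x ∈ e) : T.Fixes (T.edgeStab e) x := by
  induction e using Sym2.ind with
  | _ a b =>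
    intro g hg
    have h := (hT.mem_edgeStab he).1 hg
    rcases Sym2.mem_iff.1 hx with rfl | rfl
    exacts [h.1, h.2]

theorem Fixes.mono {T : GGraph G} {A B : Subgroup G} {v : T.V} (h : T.Fixes B v) (hAB : A ≤ B) :
    T.Fixes A v := fun g hg => h g (hAB hg)

theorem Elliptic.mono {T : GGraph G} {A B : Subgroup G} (h : T.Elliptic B) (hAB : A ≤ B) :
    T.Elliptic A := h.imp fun _ hv => hv.mono hAB

theorem Fixes.conj {T : GGraph G} {A : Subgroup G} {v : T.V} (h : T.Fixes A v) (g : G) :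
    T.Fixes (Cylinders.conj g A) (g • v) := by
  rintro _ ⟨k, hk, rfl⟩
  change (g * k * g⁻¹) • g • v = g • v
  rw [← mul_smul, inv_mul_cancel_right, mul_smul, h k hk]

theorem Elliptic.conj {T : GGraph G} {A : Subgroup G} (h : T.Elliptic A) (g : G) :
    T.Elliptic (Cylinders.conj g A) := by
  obtain ⟨v, hv⟩ := h
  exact ⟨_, hv.conj g⟩

theorem Elliptic.map {T T' : GGraph G} {A : Subgroup G} (h : T.Elliptic A) (f : T.V → T'.V)
    (hf : ∀ (g : G) x, f (g • x) = g • f x) : T'.Elliptic A := by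
  obtain ⟨v, hv⟩ := h
  exact ⟨f v, fun g hg => by rw [← hf, hv g hg]⟩

theorem edgeStab_le_map {T T' : GGraph G} (f : T.V → T'.V)
    (hf : ∀ (g : G) x, f (g • x) = g • f x) (x y : T.V) :
    T.edgeStab s(x, y) ≤ T'.edgeStab s(f x, f y) := by
  intro g hg
  have h : s(g • x, g • y) = s(x, y) := hg
  change s(g • f x, g • f y) = s(f x, f y)
  rw [← hf, ← hf]
  exact congrArg (Sym2.map f) h

theorem isConvex_preimage_smul {T : GGraph G} (g : G) {C : Set T.V} (hC : IsConvex T.graph C) :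
    IsConvex T.graph {v | g • v ∈ C} := by
  intro a ha b hb p hp x hx
  obtain ⟨q, hq⟩ := exists_map_walk (fun x => g • x) (T.smul_adj g) p rfl rfl
  refine hC _ ha _ hb q (isPath_of_support hp (MulAction.injective g) hq) _ ?_
  rw [hq]
  exact List.mem_map_of_mem hx

theorem smul_mem_hull {T : GGraph G} (g : G) {A B : Set T.V} (hAB : ∀ a ∈ A, g • a ∈ B) {v : T.V}
    (hv : v ∈ hull T.graph A) : g • v ∈ hull T.graph B := fun _ hC hB =>
  hv _ (isConvex_preimage_smul g hC) fun a ha => hB (hAB a ha)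

theorem isConvex_fixed {T : GGraph G} (hT : T.graph.IsAcyclic) (g : G) :
    IsConvex T.graph {v | g • v = v} := by
  intro a ha b hb p hp x hx
  obtain ⟨q, hq⟩ := exists_map_walk (fun x => g • x) (T.smul_adj g) p ha hb
  have h := path_unique hT (isPath_of_support hp (MulAction.injective g) hq) hp
  rw [h] at hq
  have h3 : p.support.map (fun x => g • x) = p.support.map id := by rw [← hq, List.map_id]
  exact List.map_inj_left.1 h3 x hx

/-- The fixed set of `g` is convex, and the path from `a` to `b` crosses the edge `xy`. -/
theorem _root_.Cylinders.IsCut.fixes {T : GGraph G} (hT : T.graph.IsTree) {x y a b : T.V}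
    {S : Set T.V} (hS : IsCut T.graph x y S) (ha : a ∈ S) (hb : b ∉ S) {g : G}
    (hga : g • a = a) (hgb : g • b = b) : g • x = x ∧ g • y = y := by
  obtain ⟨p, hp⟩ := exists_path hT.connected a b
  obtain ⟨d, hd, h1, h2⟩ := p.exists_boundary_dart S ha hb
  obtain ⟨rfl, rfl⟩ := hS.eq _ _ d.adj h1 h2
  have hc := isConvex_fixed hT.isAcyclic g a hga b hgb p hp
  exact ⟨hc _ (p.dart_fst_mem_support_of_mem_darts hd),
    hc _ (p.dart_snd_mem_support_of_mem_darts hd)⟩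

theorem edgeInSegment_of_adj {T : GGraph G} {x y : T.V} (hxy : T.graph.Adj x y) :
    T.EdgeInSegment s(x, y) x y :=
  ⟨SimpleGraph.Walk.cons hxy SimpleGraph.Walk.nil, by simp [hxy.ne], by simp⟩

/-- Conjugating a projection by an element preserving `C` gives a projection onto `C`, and
projections are unique. -/
theorem _root_.Cylinders.IsProjection.smul {T : GGraph G} (hT : T.graph.Connected) {C : Set T.V}
    {π : T.V → T.V} (hπ : IsProjection T.graph C π) {g : G} (hg : ∀ x, g • x ∈ C ↔ x ∈ C)
    (v : T.V) : π (g • v) = g • π v := by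
  have h : IsProjection T.graph C fun v => g⁻¹ • π (g • v) := by
    refine ⟨fun v => ?_, fun v hv => ?_, fun u v huv hn => ?_⟩
    · rw [← hg, smul_inv_smul]
      exact hπ.mem _
    · rw [hπ.eq_self _ ((hg v).2 hv), inv_smul_smul]
    · rw [hπ.eq_of_adj (g • u) (g • v) (T.smul_adj g u v huv)
        (by rwa [hg, hg])]
  rw [hπ.unique hT h v, smul_inv_smul]

/-- The projection onto an invariant subtree is equivariant, so it carries a fixed vertex to a fixed
vertex of the subtree. -/
theorem exists_fixes_mem {T : GGraph G} (hT : T.graph.IsTree) {C : Set T.V}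
    (hC : IsConvex T.graph C) (hne : C.Nonempty) {A : Subgroup G}
    (hA : ∀ g ∈ A, ∀ x ∈ C, g • x ∈ C) (h : T.Elliptic A) : ∃ v ∈ C, T.Fixes A v := by
  obtain ⟨π, hπ⟩ := exists_projection hT hC hne
  obtain ⟨v, hv⟩ := h
  refine ⟨π v, hπ.mem v, fun g hg => ?_⟩
  rw [← hπ.smul hT.connected (g := g) (fun x => ⟨fun hx => ?_, hA g hg x⟩), hv g hg]
  simpa using hA g⁻¹ (A.inv_mem hg) _ hx

/-- The `G`-graph induced on an invariant set of vertices. -/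
def restrict (X : GGraph G) (C : Set X.V) (hC : ∀ (g : G), ∀ x ∈ C, g • x ∈ C) : GGraph G where
  V := C
  act :=
    { smul := fun g x => ⟨g • x.1, hC g x.1 x.2⟩
      one_smul := fun x => Subtype.ext (one_smul G x.1)
      mul_smul := fun g h x => Subtype.ext (mul_smul g h x.1) }
  graph := X.graph.induce C
  smul_adj g x y h := X.smul_adj g x.1 y.1 h

section Restrict

variable {X : GGraph G} {C : Set X.V} {hC : ∀ (g : G), ∀ x ∈ C, g • x ∈ C}

theorem isGTree_restrict (hX : X.IsGTree) (hconv : IsConvex X.graph C) (hne : C.Nonempty) :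
    (X.restrict C hC).IsGTree where
  isTree := ⟨hconv.induce_connected hX.isTree.connected hne, hX.isTree.isAcyclic.induce C⟩
  no_inversion g x y hxy h :=
    hX.no_inversion g x.1 y.1 hxy ⟨congrArg Subtype.val h.1, congrArg Subtype.val h.2⟩

theorem isConvex_image_val (hX : X.graph.IsAcyclic)
    (hconn : (X.restrict C hC).graph.Connected) {D : Set (X.restrict C hC).V}
    (hD : IsConvex (X.restrict C hC).graph D) : IsConvex X.graph (Subtype.val '' D) := by
  refine isConvex_of_walks hX ?_
  rintro _ ⟨a, ha, rfl⟩ _ ⟨b, hb, rfl⟩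
  obtain ⟨w, hw⟩ := hD.exists_walk hconn ha hb
  obtain ⟨q, hq⟩ := exists_map_walk (Δ := X.graph) Subtype.val (fun _ _ h => h) w rfl rfl
  refine ⟨q, fun x hx => ?_⟩
  rw [hq, List.mem_map] at hx
  obtain ⟨z, hz, rfl⟩ := hx
  exact ⟨z, hw z hz, rfl⟩

end Restrict

/-! ### Collapsing an invariant set of edges -/

/-- The action on the set of connected components of the subgraph of collapsed edges. -/
@[reducible] def collapseAction (T : GGraph G) (K : Set (Sym2 T.V))
    (hK : ∀ (g : G), ∀ e ∈ K, g • e ∈ K) :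
    MulAction G (T.graph.deleteEdges K).ConnectedComponent where
  smul := fun g => SimpleGraph.ConnectedComponent.map
      ⟨fun x => g • x, fun {x y} h => by
        rw [SimpleGraph.deleteEdges_adj] at h ⊢
        exact ⟨T.smul_adj g x y h.1, fun h' => h.2 (by simpa [smul_mk] using hK g⁻¹ _ h')⟩⟩
  one_smul := fun c => by
      induction c using SimpleGraph.ConnectedComponent.ind with
      | _ x => exact congrArg _ (one_smul G x)
  mul_smul := fun g h c => by
      induction c using SimpleGraph.ConnectedComponent.ind with
      | _ x => exact congrArg _ (mul_smul g h x)

/-- The result of collapsing all the edges of `T` which are not in `K`. -/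
def collapse (T : GGraph G) (K : Set (Sym2 T.V)) (hK : ∀ (g : G), ∀ e ∈ K, g • e ∈ K) :
    GGraph G where
  V := (T.graph.deleteEdges K).ConnectedComponent
  act := T.collapseAction K hK
  graph :=
    { Adj := fun c d => c ≠ d ∧ ∃ x y, (T.graph.deleteEdges K).connectedComponentMk x = c ∧
        (T.graph.deleteEdges K).connectedComponentMk y = d ∧ T.graph.Adj x y
      symm := ⟨fun c d h => by
        obtain ⟨hne, x, y, hx, hy, h⟩ := h
        exact ⟨hne.symm, y, x, hy, hx, h.symm⟩⟩
      loopless := ⟨fun c h => h.1 rfl⟩ }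
  smul_adj := by
    rintro g c d ⟨hne, x, y, rfl, rfl, h⟩
    refine ⟨fun h => hne ?_, g • x, g • y, rfl, rfl, T.smul_adj g x y h⟩
    exact @MulAction.injective _ _ _ (T.collapseAction K hK) g _ _ h

section Collapse

variable {T : GGraph G} {K : Set (Sym2 T.V)} {hK : ∀ (g : G), ∀ e ∈ K, g • e ∈ K}

/-- The quotient map onto the collapsed graph. -/
def toCollapse (T : GGraph G) (K : Set (Sym2 T.V)) (hK : ∀ (g : G), ∀ e ∈ K, g • e ∈ K)
    (x : T.V) : (T.collapse K hK).V := (T.graph.deleteEdges K).connectedComponentMk x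

theorem toCollapse_smul (g : G) (x : T.V) :
    T.toCollapse K hK (g • x) = g • T.toCollapse K hK x := rfl

theorem toCollapse_surjective : Function.Surjective (T.toCollapse K hK) := fun c =>
  c.ind fun x => ⟨x, rfl⟩

theorem toCollapse_eq_of_notMem {x y : T.V} (hxy : T.graph.Adj x y) (he : s(x, y) ∉ K) :
    T.toCollapse K hK x = T.toCollapse K hK y :=
  SimpleGraph.ConnectedComponent.sound (SimpleGraph.Adj.reachable (by
    rw [SimpleGraph.deleteEdges_adj]; exact ⟨hxy, he⟩))

theorem isConvex_toCollapse_fiber (hT : T.graph.IsAcyclic) (c : (T.collapse K hK).V) :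
    IsConvex T.graph {x | T.toCollapse K hK x = c} := by
  classical
  refine isConvex_of_walks hT fun a ha b hb => ?_
  obtain ⟨p⟩ := SimpleGraph.ConnectedComponent.exact (Eq.trans (b := c) ha hb.symm)
  refine ⟨p.mapLe (SimpleGraph.deleteEdges_le K), fun x hx => ?_⟩
  rw [SimpleGraph.Walk.support_mapLe_eq_support] at hx
  exact (SimpleGraph.ConnectedComponent.sound ⟨(p.takeUntil x hx)⟩).symm.trans ha

/-- A walk without edges of `K` cannot cross the kept edge `xy`. Thus sides of kept edges are unions
of collapsed components, and cuts descend to the quotient. -/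
theorem _root_.Cylinders.IsCut.mem_iff_of_toCollapse_eq {x y : T.V} {S : Set T.V}
    (hS : IsCut T.graph x y S) (he : s(x, y) ∈ K) {u v : T.V}
    (h : T.toCollapse K hK u = T.toCollapse K hK v) : u ∈ S ↔ v ∈ S := by
  have key : ∀ u v, (T.graph.deleteEdges K).Reachable u v → u ∈ S → v ∈ S := by
    rintro u v ⟨p⟩ hu
    by_contra hv
    obtain ⟨d, -, h1, h2⟩ := p.exists_boundary_dart S hu hv
    have hadj := d.adj
    rw [SimpleGraph.deleteEdges_adj] at hadj
    obtain ⟨e1, e2⟩ := hS.eq _ _ hadj.1 h1 h2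
    exact hadj.2 (by rw [e1, e2]; exact he)
  have h' := SimpleGraph.ConnectedComponent.exact h
  exact ⟨key _ _ h', key _ _ h'.symm⟩

theorem toCollapse_ne (hT : T.graph.IsAcyclic) {x y : T.V} (hxy : T.graph.Adj x y)
    (he : s(x, y) ∈ K) : T.toCollapse K hK x ≠ T.toCollapse K hK y := by
  obtain ⟨S, hS⟩ := exists_cut hT hxy
  exact fun h => hS.right ((hS.mem_iff_of_toCollapse_eq he h).1 hS.left)

theorem collapse_adj (hT : T.graph.IsAcyclic) {x y : T.V} (hxy : T.graph.Adj x y)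
    (he : s(x, y) ∈ K) : (T.collapse K hK).graph.Adj (T.toCollapse K hK x) (T.toCollapse K hK y) :=
  ⟨toCollapse_ne hT hxy he, x, y, rfl, rfl, hxy⟩

theorem exists_of_collapse_adj {c d : (T.collapse K hK).V} (h : (T.collapse K hK).graph.Adj c d) :
    ∃ x y, T.graph.Adj x y ∧ s(x, y) ∈ K ∧ T.toCollapse K hK x = c ∧ T.toCollapse K hK y = d := by
  obtain ⟨hne, x, y, rfl, rfl, hxy⟩ := h
  refine ⟨x, y, hxy, ?_, rfl, rfl⟩
  by_contra he
  exact hne (toCollapse_eq_of_notMem (hK := hK) hxy he)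

theorem eq_of_toCollapse_eq (hT : T.graph.IsAcyclic) {x y x' y' : T.V} (hxy : T.graph.Adj x y)
    (he : s(x, y) ∈ K) (hxy' : T.graph.Adj x' y')
    (hx : T.toCollapse K hK x' = T.toCollapse K hK x)
    (hy : T.toCollapse K hK y' = T.toCollapse K hK y) : x' = x ∧ y' = y := by
  obtain ⟨S, hS⟩ := exists_cut hT hxy
  exact hS.eq _ _ hxy' ((hS.mem_iff_of_toCollapse_eq he hx).2 hS.left)
    fun h => hS.right ((hS.mem_iff_of_toCollapse_eq he hy).1 h)

theorem collapse_edgeStab (hT : T.graph.IsAcyclic) {x y : T.V} (hxy : T.graph.Adj x y)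
    (he : s(x, y) ∈ K) :
    (T.collapse K hK).edgeStab s(T.toCollapse K hK x, T.toCollapse K hK y) =
      T.edgeStab s(x, y) := by
  refine le_antisymm (fun g hg => ?_) (edgeStab_le_map _ toCollapse_smul x y)
  have h : s(T.toCollapse K hK (g • x), T.toCollapse K hK (g • y)) =
    s(T.toCollapse K hK x, T.toCollapse K hK y) := hg
  change s(g • x, g • y) = s(x, y)
  have hg := T.smul_adj g x y hxy
  rcases Sym2.eq_iff.1 h with h | h
  · obtain ⟨h1, h2⟩ := eq_of_toCollapse_eq hT hxy he hg h.1 h.2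
    rw [h1, h2]
  · obtain ⟨h1, h2⟩ := eq_of_toCollapse_eq hT hxy he hg.symm h.2 h.1
    rw [h1, h2, Sym2.eq_swap]

theorem isGTree_collapse (hT : T.IsGTree) : (T.collapse K hK).IsGTree where
  isTree := by
    refine isTree_of_cuts ?_ ?_
    · have : Nonempty (T.collapse K hK).V := hT.isTree.connected.nonempty.map (T.toCollapse K hK)
      refine ⟨fun c d => ?_⟩
      obtain ⟨x, rfl⟩ := toCollapse_surjective c
      obtain ⟨y, rfl⟩ := toCollapse_surjective d
      obtain ⟨p⟩ := hT.isTree.connected x y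
      induction p with
      | nil => exact SimpleGraph.Reachable.refl _
      | @cons a b _ hab p ih =>
        refine SimpleGraph.Reachable.trans ?_ ih
        by_cases he : s(a, b) ∈ K
        · exact (collapse_adj hT.isTree.isAcyclic hab he).reachable
        · rw [toCollapse_eq_of_notMem hab he]
    · intro c d hcd
      obtain ⟨x, y, hxy, he, rfl, rfl⟩ := exists_of_collapse_adj hcd
      obtain ⟨S, hS⟩ := exists_cut hT.isTree.isAcyclic hxy
      have hmem : ∀ z, T.toCollapse K hK z ∈ T.toCollapse K hK '' S ↔ z ∈ S := fun z =>
        ⟨fun ⟨w, hw, h⟩ => (hS.mem_iff_of_toCollapse_eq he h).1 hw, fun h => ⟨z, h, rfl⟩⟩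
      refine ⟨T.toCollapse K hK '' S, (hmem x).2 hS.left, fun h => hS.right ((hmem y).1 h), ?_⟩
      intro c d hcd hc hd
      obtain ⟨u, v, huv, -, rfl, rfl⟩ := exists_of_collapse_adj hcd
      rw [hmem] at hc hd
      obtain ⟨rfl, rfl⟩ := hS.eq u v huv hc hd
      exact ⟨rfl, rfl⟩
  no_inversion g c d hcd h := by
    obtain ⟨x, y, hxy, he, rfl, rfl⟩ := exists_of_collapse_adj hcd
    rw [← toCollapse_smul, ← toCollapse_smul] at h
    obtain ⟨h1, h2⟩ := eq_of_toCollapse_eq hT.isTree.isAcyclic hxy he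
      (T.smul_adj g x y hxy).symm h.2 h.1
    exact hT.no_inversion g x y hxy ⟨h2, h1⟩

theorem exists_of_mem_collapse_edges {e : Sym2 (T.collapse K hK).V}
    (he : e ∈ (T.collapse K hK).edges) : ∃ x y, T.graph.Adj x y ∧ s(x, y) ∈ K ∧
      e = s(T.toCollapse K hK x, T.toCollapse K hK y) := by
  induction e using Sym2.ind with
  | _ c d =>
    obtain ⟨x, y, hxy, hK, rfl, rfl⟩ := exists_of_collapse_adj he
    exact ⟨x, y, hxy, hK, rfl⟩

end Collapse

end GGraph

/-! ### Directions at a vertex and equivariant choices -/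

/-- A choice, for every vertex `z ≠ p` of an acyclic graph, of the neighbour of `p` in the direction
of `z`. -/
theorem exists_direction {V : Type u} {Γ : SimpleGraph V} (hΓ : Γ.IsAcyclic) (p : V) :
    ∃ δ : V → V, (∀ q, Γ.Adj p q → δ q = q) ∧
      ∀ r s, Γ.Adj r s → r ≠ p → s ≠ p → δ r = δ s := by
  let H : SimpleGraph V :=
    { Adj := fun u v => Γ.Adj u v ∧ u ≠ p ∧ v ≠ p
      symm := ⟨fun u v h => ⟨h.1.symm, h.2.2, h.2.1⟩⟩
      loopless := ⟨fun u h => h.1.ne rfl⟩ }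
  have huniq : ∀ q q', Γ.Adj p q → Γ.Adj p q' → H.Reachable q q' → q = q' := by
    rintro q q' hq hq' ⟨w⟩
    by_contra hne
    -- Since `q'` is on the side of `p` in the cut along `pq`, a walk from `q` to `q'` has to pass
    -- through `p`.
    obtain ⟨S, hS⟩ := exists_cut hΓ hq
    have hq'S : q' ∈ S := by
      by_contra h
      exact hne (hS.eq p q' hq' hS.left h).2.symm
    obtain ⟨d, -, h1, h2⟩ := w.exists_boundary_dart Sᶜ hS.right (not_not.2 hq'S)
    exact d.adj.2.2 (hS.compl.eq _ _ d.adj.1 h1 h2).2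
  have : Nonempty V := ⟨p⟩
  -- The predicate depends only on the component of `z` away from `p`, so adjacent vertices receive
  -- literally the same choice.
  refine ⟨fun z => Classical.epsilon fun q => Γ.Adj p q ∧ H.Reachable q z, ?_, ?_⟩
  · intro q hq
    have h := Classical.epsilon_spec
      (p := fun q' => Γ.Adj p q' ∧ H.Reachable q' q) ⟨q, hq, SimpleGraph.Reachable.refl _⟩
    exact huniq _ _ h.1 hq h.2
  · intro r s hrs hr hs
    have hadj : H.Adj r s := ⟨hrs, hr, hs⟩
    have : (fun q => Γ.Adj p q ∧ H.Reachable q r) = fun q => Γ.Adj p q ∧ H.Reachable q s := by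
      funext q
      exact propext ⟨fun h => ⟨h.1, h.2.trans hadj.reachable⟩,
        fun h => ⟨h.1, h.2.trans hadj.symm.reachable⟩⟩
    simp only [this]

/-- Points with prescribed invariant properties can be chosen equivariantly, if they can be chosen
invariant under stabilizers. -/
theorem exists_equivariant_choice {G X V : Type u} [Group G] [MulAction G X] [MulAction G V]
    [Nonempty V] (D : X → Prop) (Q : X → V → Prop) (hD : ∀ (g : G) x, D x → D (g • x))
    (hQ : ∀ (g : G) x v, Q x v → Q (g • x) (g • v))
    (h : ∀ x, D x → ∃ v, Q x v ∧ ∀ g : G, g • x = x → g • v = v) :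
    ∃ a : X → V, (∀ x, D x → Q x (a x)) ∧ ∀ (g : G) x, D x → a (g • x) = g • a x := by
  classical
  let rep : X → X := fun x => (Quotient.mk (MulAction.orbitRel G X) x).out
  have hrep : ∀ x, ∃ g : G, g • rep x = x := fun x =>
    (MulAction.orbitRel G X).symm (Quotient.mk_out (s := MulAction.orbitRel G X) x)
  have hrep' : ∀ (g : G) x, rep (g • x) = rep x := fun g x =>
    congrArg Quotient.out (Quotient.sound (s := MulAction.orbitRel G X) ⟨g, rfl⟩)
  choose k hk using hrep
  choose! b hb hb' using h
  have hDr : ∀ x, D x → D (rep x) := fun x hx => by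
    rw [show rep x = (k x)⁻¹ • x by rw [eq_inv_smul_iff, hk]]
    exact hD _ _ hx
  refine ⟨fun x => k x • b (rep x), fun x hx => ?_, fun g x hx => ?_⟩
  · have := hQ (k x) _ _ (hb _ (hDr x hx))
    rwa [hk] at this
  -- Two transporters from the representative to `g • x` differ by an element of its stabilizer,
  -- which fixes the chosen point.
  · have h1 : ((k x)⁻¹ * g⁻¹ * k (g • x)) • rep x = rep x := by
      have h2 := hk (g • x)
      rw [hrep'] at h2
      rw [mul_smul, mul_smul, h2, inv_smul_smul, inv_smul_eq_iff, hk]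
    have h3 := hb' _ (hDr x hx) _ h1
    change k (g • x) • b (rep (g • x)) = g • k x • b (rep x)
    rw [hrep']
    rw [mul_smul, mul_smul, inv_smul_eq_iff, inv_smul_eq_iff] at h3
    exact h3

/-! ### Minimal invariant subtrees and one-edge splittings -/

namespace GGraph

variable {G : Type u} [Group G]

/-- Finite generation yields an invariant subtree with finitely many vertex orbits; among its
invariant subtrees, one with the fewest orbits is minimal. -/
theorem exists_minimal_invariant [Group.FG G] {X : GGraph G} (hX : X.IsGTree) :
    ∃ M : Set X.V, IsConvex X.graph M ∧ M.Nonempty ∧ (∀ (g : G), ∀ x ∈ M, g • x ∈ M) ∧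
      ∀ D ⊆ M, IsConvex X.graph D → D.Nonempty → (∀ (g : G), ∀ x ∈ D, g • x ∈ D) → D = M := by
  classical
  obtain ⟨v₀⟩ := hX.isTree.connected.nonempty
  obtain ⟨S, hS⟩ := (Group.fg_def (G := G)).1 inferInstance
  choose p hp using fun g : G => exists_path hX.isTree.connected v₀ (g • v₀)
  -- Translates of the finitely many paths from `v₀` to its images under the generators form a
  -- connected set.
  let K : Set X.V := {v₀} ∪ ⋃ s ∈ S, {x | x ∈ (p s).support}
  have hKfin : K.Finite := (Set.finite_singleton v₀).union
    (S.finite_toSet.biUnion fun s _ => List.finite_toSet _)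
  let M₀ : Set X.V := {x | ∃ g : G, ∃ k ∈ K, x = g • k}
  have hinv : ∀ (g : G), ∀ x ∈ M₀, g • x ∈ M₀ := by
    rintro g _ ⟨h, k, hk, rfl⟩
    exact ⟨g * h, k, hk, (mul_smul g h k).symm⟩
  have htrans : ∀ (g : G) (a b : X.V), (∃ w : X.graph.Walk a b, ∀ x ∈ w.support, x ∈ M₀) →
      ∃ w : X.graph.Walk (g • a) (g • b), ∀ x ∈ w.support, x ∈ M₀ := by
    rintro g a b ⟨w, hw⟩
    obtain ⟨q, hq⟩ := exists_map_walk (fun x => g • x) (X.smul_adj g) w rfl rfl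
    refine ⟨q, fun x hx => ?_⟩
    rw [hq, List.mem_map] at hx
    obtain ⟨z, hz, rfl⟩ := hx
    exact hinv g z (hw z hz)
  have happ : ∀ a b c : X.V, (∃ w : X.graph.Walk a b, ∀ x ∈ w.support, x ∈ M₀) →
      (∃ w : X.graph.Walk b c, ∀ x ∈ w.support, x ∈ M₀) →
      ∃ w : X.graph.Walk a c, ∀ x ∈ w.support, x ∈ M₀ := by
    rintro a b c ⟨w, hw⟩ ⟨w', hw'⟩
    refine ⟨w.append w', fun x hx => ?_⟩
    rcases SimpleGraph.Walk.mem_support_append_iff _ _ |>.1 hx with hx | hx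
    exacts [hw x hx, hw' x hx]
  have hrev : ∀ a b : X.V, (∃ w : X.graph.Walk a b, ∀ x ∈ w.support, x ∈ M₀) →
      ∃ w : X.graph.Walk b a, ∀ x ∈ w.support, x ∈ M₀ := by
    rintro a b ⟨w, hw⟩
    exact ⟨w.reverse, fun x hx => hw x (by simpa using hx)⟩
  have hKM : ∀ k ∈ K, k ∈ M₀ := fun k hk => ⟨1, k, hk, (one_smul G k).symm⟩
  have hv₀ : v₀ ∈ M₀ := hKM _ (Or.inl rfl)
  have hS' : ∀ s ∈ S, ∀ x ∈ (p s).support, x ∈ K := fun s hs x hx =>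
    Or.inr (Set.mem_iUnion₂.2 ⟨s, hs, hx⟩)
  have horb : ∀ g : G, ∃ w : X.graph.Walk v₀ (g • v₀), ∀ x ∈ w.support, x ∈ M₀ := by
    intro g
    have hg : g ∈ Subgroup.closure (S : Set G) := by rw [hS]; trivial
    induction hg using Subgroup.closure_induction with
    | mem s hs => exact ⟨p s, fun x hx => hKM x (hS' s hs x hx)⟩
    | one =>
      rw [one_smul]
      refine ⟨SimpleGraph.Walk.nil, fun x hx => ?_⟩
      rw [SimpleGraph.Walk.support_nil, List.mem_singleton] at hx
      exact hx ▸ hv₀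
    | mul g h _ _ ihg ihh =>
      rw [mul_smul]
      exact happ _ _ _ ihg (htrans g _ _ ihh)
    | inv g _ ih =>
      have := hrev _ _ (htrans g⁻¹ _ _ ih)
      rwa [inv_smul_smul] at this
  have hK : ∀ k ∈ K, ∃ w : X.graph.Walk v₀ k, ∀ x ∈ w.support, x ∈ M₀ := by
    rintro k (rfl | hk)
    · have h := horb 1
      rwa [one_smul] at h
    · obtain ⟨s, hs, hk⟩ := Set.mem_iUnion₂.1 hk
      exact ⟨(p s).takeUntil k hk, fun x hx =>
        hKM x (hS' s hs x ((p s).support_takeUntil_subset_support hk hx))⟩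
  have hM₀ : ∀ m ∈ M₀, ∃ w : X.graph.Walk v₀ m, ∀ x ∈ w.support, x ∈ M₀ := by
    rintro _ ⟨g, k, hk, rfl⟩
    exact happ _ _ _ (horb g) (htrans g _ _ (hK k hk))
  have hconv : IsConvex X.graph M₀ := isConvex_of_walks hX.isTree.isAcyclic fun a ha b hb =>
    happ _ _ _ (hrev _ _ (hM₀ a ha)) (hM₀ b hb)
  let q : X.V → Quotient (MulAction.orbitRel G X.V) := Quotient.mk _
  have hq : ∀ (g : G) x, q (g • x) = q x := fun g x =>
    Quotient.sound (s := MulAction.orbitRel G X.V) ⟨g, rfl⟩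
  have hfin : (q '' M₀).Finite := by
    refine (hKfin.image q).subset ?_
    rintro _ ⟨_, ⟨g, k, hk, rfl⟩, rfl⟩
    exact ⟨k, hk, (hq g k).symm⟩
  obtain ⟨M, ⟨hM1, hM2, hM3, hM4⟩, hmin⟩ := WellFounded.has_min
    (measure fun D : Set X.V => (q '' D).ncard).wf
    {D | D ⊆ M₀ ∧ IsConvex X.graph D ∧ D.Nonempty ∧ ∀ (g : G), ∀ x ∈ D, g • x ∈ D}
    ⟨M₀, subset_rfl, hconv, ⟨v₀, hv₀⟩, hinv⟩
  refine ⟨M, hM2, hM3, hM4, fun D hDM hD hne hDinv => ?_⟩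
  by_contra hDne
  obtain ⟨x, hxM, hxD⟩ := Set.exists_of_ssubset (hDM.ssubset_of_ne hDne)
  refine hmin D ⟨hDM.trans hM1, hD, hne, hDinv⟩ (Set.ncard_lt_ncard ?_
    (hfin.subset (Set.image_mono hM1)))
  refine ⟨Set.image_mono hDM, fun h => hxD ?_⟩
  obtain ⟨y, hy, hyx⟩ := h ⟨x, hxM, rfl⟩
  obtain ⟨g, hg⟩ := (MulAction.orbitRel G X.V).symm (Quotient.exact hyx)
  exact hg ▸ hDinv g y hy

theorem isMinimal_restrict {X : GGraph G} (hX : X.graph.IsTree) {M : Set X.V}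
    (hM : IsConvex X.graph M) (hne : M.Nonempty) (hinv : ∀ (g : G), ∀ x ∈ M, g • x ∈ M)
    (hmin : ∀ D ⊆ M, IsConvex X.graph D → D.Nonempty → (∀ (g : G), ∀ x ∈ D, g • x ∈ D) → D = M) :
    (X.restrict M hinv).IsMinimal := by
  intro S hS hSinv
  have hconn : (X.restrict M hinv).graph.Connected := hM.induce_connected hX.connected hne
  have hSconv : IsConvex (X.restrict M hinv).graph S :=
    isConvex_of_induce_connected (hX.isAcyclic.induce M) hS.preconnected
  obtain ⟨s⟩ := hS.nonempty
  have h := hmin (Subtype.val '' S) (by rintro _ ⟨x, -, rfl⟩; exact x.2)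
    (isConvex_image_val hX.isAcyclic hconn hSconv) ⟨_, s.1, s.2, rfl⟩ (by
      rintro g _ ⟨x, hx, rfl⟩
      exact ⟨_, hSinv g x hx, rfl⟩)
  refine Set.eq_univ_of_forall fun x => ?_
  have hx : x.1 ∈ Subtype.val '' S := h.symm ▸ x.2
  obtain ⟨y, hy, hyx⟩ := hx
  rwa [Subtype.ext hyx] at hy

/-- `G` splits over the edge stabilizers of a minimal `G`-tree. -/
theorem splitsOver_edgeStab {X : GGraph G} (hX : X.IsGTree) (hmin : X.IsMinimal)
    {𝓗 : Set (Subgroup G)} (hH : ∀ H ∈ 𝓗, X.Elliptic H) {x y : X.V} (hxy : X.graph.Adj x y) :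
    SplitsOver 𝓗 (X.edgeStab s(x, y)) := by
  let K : Set (Sym2 X.V) := {e | ∃ g : G, g • s(x, y) = e}
  have hK : ∀ (g : G), ∀ e ∈ K, g • e ∈ K := by
    rintro g _ ⟨h, rfl⟩
    exact ⟨g * h, mul_smul g h _⟩
  have hxyK : s(x, y) ∈ K := ⟨1, one_smul G _⟩
  refine ⟨X.collapse K hK, isGTree_collapse hX, fun H h => (hH H h).map _ toCollapse_smul, ?_,
    s(X.toCollapse K hK x, X.toCollapse K hK y), collapse_adj (hK := hK) hX.isTree.isAcyclic hxy hxyK,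
    collapse_edgeStab (hK := hK) hX.isTree.isAcyclic hxy hxyK, ?_⟩
  · rintro ⟨c, hc⟩
    -- The fibre over a global fixed point is an invariant subtree, hence everything by minimality,
    -- yet the kept edge joins distinct fibres.
    have hconv := isConvex_toCollapse_fiber (hK := hK) hX.isTree.isAcyclic c
    have huniv := hmin {z | X.toCollapse K hK z = c}
      (hconv.induce_connected hX.isTree.connected (toCollapse_surjective c))
      (fun g z hz => by
        change X.toCollapse K hK (g • z) = c
        rw [toCollapse_smul, show X.toCollapse K hK z = c from hz]
        exact hc g trivial)
    have h1 : X.toCollapse K hK x = c := by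
      have : x ∈ {z | X.toCollapse K hK z = c} := huniv ▸ Set.mem_univ x
      exact this
    have h2 : X.toCollapse K hK y = c := by
      have : y ∈ {z | X.toCollapse K hK z = c} := huniv ▸ Set.mem_univ y
      exact this
    exact toCollapse_ne (hK := hK) hX.isTree.isAcyclic hxy hxyK (h1.trans h2.symm)
  · intro e' he'
    obtain ⟨x', y', -, ⟨g, hg⟩, rfl⟩ := exists_of_mem_collapse_edges he'
    exact ⟨g, congrArg (Sym2.map (X.toCollapse K hK)) hg⟩

/-! ### Blow-ups and common refinements -/

/-- The graph obtained from `S` by replacing each vertex `p` by the subgraph of `T` induced on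
`F p`, and attaching the edge `pq` to the points `a p q` and `a q p`. -/
def blowup (S T : GGraph G) (F : S.V → Set T.V) (a : S.V → S.V → T.V)
    (hF : ∀ (g : G) p v, v ∈ F p → g • v ∈ F (g • p))
    (ha : ∀ (g : G) p q, S.graph.Adj p q → a (g • p) (g • q) = g • a p q) : GGraph G where
  V := {z : S.V × T.V // z.2 ∈ F z.1}
  act :=
    { smul := fun g z => ⟨(g • z.1.1, g • z.1.2), hF g _ _ z.2⟩
      one_smul := fun z => Subtype.ext (Prod.ext (one_smul G z.1.1) (one_smul G z.1.2))
      mul_smul := fun g h z =>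
        Subtype.ext (Prod.ext (mul_smul g h z.1.1) (mul_smul g h z.1.2)) }
  graph :=
    { Adj := fun z w => (z.1.1 = w.1.1 ∧ T.graph.Adj z.1.2 w.1.2) ∨
        (S.graph.Adj z.1.1 w.1.1 ∧ z.1.2 = a z.1.1 w.1.1 ∧ w.1.2 = a w.1.1 z.1.1)
      symm := ⟨by
        rintro z w (h | h)
        · exact Or.inl ⟨h.1.symm, h.2.symm⟩
        · exact Or.inr ⟨h.1.symm, h.2.2, h.2.1⟩⟩
      loopless := ⟨by
        rintro z (h | h)
        · exact h.2.ne rfl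
        · exact h.1.ne rfl⟩ }
  smul_adj := by
    rintro g z w (h | h)
    · exact Or.inl ⟨congrArg (g • ·) h.1, T.smul_adj g _ _ h.2⟩
    · exact Or.inr ⟨S.smul_adj g _ _ h.1, (congrArg (g • ·) h.2.1).trans (ha g _ _ h.1).symm,
        (congrArg (g • ·) h.2.2).trans (ha g _ _ h.1.symm).symm⟩

section Blowup

variable {S T : GGraph G} {F : S.V → Set T.V} {a : S.V → S.V → T.V}
  {hF : ∀ (g : G) p v, v ∈ F p → g • v ∈ F (g • p)}
  {ha : ∀ (g : G) p q, S.graph.Adj p q → a (g • p) (g • q) = g • a p q}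

theorem blowup_reachable_fiber (hT : T.graph.Connected) {p : S.V} (hconv : IsConvex T.graph (F p))
    {v w : T.V} (hv : v ∈ F p) (hw : w ∈ F p) :
    (blowup S T F a hF ha).graph.Reachable ⟨(p, v), hv⟩ ⟨(p, w), hw⟩ := by
  obtain ⟨q, hq⟩ := hconv.exists_walk hT hv hw
  induction q with
  | nil => exact SimpleGraph.Reachable.refl _
  | @cons b c d hbc q ih =>
    have hc : c ∈ F p := hq c (by simp)
    refine SimpleGraph.Reachable.trans (SimpleGraph.Adj.reachable (v := ⟨(p, c), hc⟩)
      (Or.inl ⟨rfl, hbc⟩)) (ih hc hw fun x hx => hq x (by simp [hx]))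

theorem isGTree_blowup (hS : S.IsGTree) (hT : T.IsGTree) (hconv : ∀ p, IsConvex T.graph (F p))
    (hne : ∀ p, (F p).Nonempty) (hmem : ∀ p q, S.graph.Adj p q → a p q ∈ F p) :
    (blowup S T F a hF ha).IsGTree where
  isTree := by
    refine isTree_of_cuts ?_ ?_
    · obtain ⟨p₀⟩ := hS.isTree.connected.nonempty
      have : Nonempty (blowup S T F a hF ha).V := ⟨⟨(p₀, _), (hne p₀).some_mem⟩⟩
      refine ⟨?_⟩
      rintro ⟨⟨p, v⟩, hv⟩ ⟨⟨q, w⟩, hw⟩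
      obtain ⟨c⟩ := hS.isTree.connected p q
      induction c generalizing v with
      | nil => exact blowup_reachable_fiber hT.isTree.connected (hconv _) hv hw
      | @cons b d _ hbd c ih =>
        refine (blowup_reachable_fiber hT.isTree.connected (hconv _) hv (hmem b d hbd)).trans ?_
        refine SimpleGraph.Reachable.trans (SimpleGraph.Adj.reachable ?_)
          (ih (a d b) (hmem d b hbd.symm) hw)
        exact Or.inr ⟨hbd, rfl, rfl⟩
    · rintro ⟨⟨p, v⟩, hv⟩ ⟨⟨q, w⟩, hw⟩ (⟨rfl : p = q, hvw : T.graph.Adj v w⟩ |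
        ⟨hpq : S.graph.Adj p q, rfl : v = a p q, rfl : w = a q p⟩)
      · obtain ⟨C, hC⟩ := exists_cut hT.isTree.isAcyclic hvw
        obtain ⟨δ, hδ, hδ'⟩ := exists_direction hS.isTree.isAcyclic p
        -- The side of a fibre edge over `p` consists of the part of this fibre in `C` and of all
        -- other fibres whose direction at `p` is attached to that part.
        refine ⟨{z | (z.1.1 = p ∧ z.1.2 ∈ C) ∨ (z.1.1 ≠ p ∧ a p (δ z.1.1) ∈ C)},
          Or.inl ⟨rfl, hC.left⟩, ?_, ?_⟩
        · rintro (⟨-, h⟩ | ⟨h, -⟩)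
          exacts [hC.right h, h rfl]
        · rintro ⟨⟨r, x⟩, hx⟩ ⟨⟨s, y⟩, hy⟩ (⟨rfl : r = s, hxy : T.graph.Adj x y⟩ |
            ⟨hrs : S.graph.Adj r s, rfl : x = a r s, rfl : y = a s r⟩) h1 h2
          · rcases h1 with ⟨rfl : r = p, h1 : x ∈ C⟩ | h1
            · have hyC : y ∉ C := fun h => h2 (Or.inl ⟨rfl, h⟩)
              obtain ⟨rfl, rfl⟩ := hC.eq x y hxy h1 hyC
              exact ⟨rfl, rfl⟩
            · exact absurd (Or.inr h1) h2
          · exfalso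
            apply h2
            rcases h1 with ⟨rfl : r = p, h1 : a r s ∈ C⟩ | ⟨h1 : r ≠ p, h1' : a p (δ r) ∈ C⟩
            · exact Or.inr ⟨hrs.ne', by change a r (δ s) ∈ C; rwa [hδ s hrs]⟩
            · by_cases hs : s = p
              · subst hs
                rw [hδ r hrs.symm] at h1'
                exact Or.inl ⟨rfl, h1'⟩
              · exact Or.inr ⟨hs, by change a p (δ s) ∈ C; rwa [← hδ' r s hrs h1 hs]⟩
      · obtain ⟨C, hC⟩ := exists_cut hS.isTree.isAcyclic hpq
        refine ⟨{z | z.1.1 ∈ C}, hC.left, hC.right, ?_⟩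
        rintro ⟨⟨r, x⟩, hx⟩ ⟨⟨s, y⟩, hy⟩ (⟨rfl : r = s, hxy : T.graph.Adj x y⟩ |
            ⟨hrs : S.graph.Adj r s, rfl : x = a r s, rfl : y = a s r⟩) h1 h2
        · exact absurd h1 h2
        · obtain ⟨rfl, rfl⟩ := hC.eq r s hrs h1 h2
          exact ⟨rfl, rfl⟩
  no_inversion := by
    rintro g z w (⟨h, hzw⟩ | ⟨hzw, -, -⟩) ⟨h1, h2⟩
    · exact hT.no_inversion g _ _ hzw ⟨congrArg (fun z => z.1.2) h1, congrArg (fun z => z.1.2) h2⟩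
    · exact hS.no_inversion g _ _ hzw ⟨congrArg (fun z => z.1.1) h1, congrArg (fun z => z.1.1) h2⟩

end Blowup

/-- A criterion for an equivariant map sending edges to edges or vertices to be a collapse map: it
is injective on the edges that are not collapsed. -/
theorem isCollapseMap_of_injective {T T' : GGraph G} (hT' : T'.graph.IsAcyclic)
    (f : T.V → T'.V) (hf : ∀ (g : G) x, f (g • x) = g • f x) (hsurj : Function.Surjective f)
    (hcell : ∀ x y, T.graph.Adj x y → f x = f y ∨ T'.graph.Adj (f x) (f y))
    (hinj : ∀ x y x' y', T.graph.Adj x y → T.graph.Adj x' y' → f x ≠ f y →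
      s(f x, f y) = s(f x', f y') → s(x, y) = s(x', y')) : IsCollapseMap T T' f where
  equivariant := hf
  surjective := hsurj
  cellular := hcell
  alignment := by
    rintro x a b ⟨p, hp, hx⟩
    obtain ⟨q, hq, hsup, -⟩ := exists_image_trail f hcell hinj p hp.isTrail
    exact ⟨q, (hT'.isPath_iff_isTrail q).2 hq, hsup x hx⟩

theorem IsCollapseMap.comp {T T' T'' : GGraph G} {f : T.V → T'.V} {f' : T'.V → T''.V}
    (h' : IsCollapseMap T' T'' f') (h : IsCollapseMap T T' f) :
    IsCollapseMap T T'' (f' ∘ f) where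
  equivariant g x := by simp only [Function.comp, h.equivariant, h'.equivariant]
  surjective := h'.surjective.comp h.surjective
  cellular x y hxy := by
    rcases h.cellular x y hxy with e | e
    · exact Or.inl (congrArg f' e)
    · exact h'.cellular _ _ e
  alignment x a b hx := h'.alignment _ _ _ (h.alignment x a b hx)

/-- Two `G`-trees `S`, `T` are compatible if `T` is the union of a family of subtrees indexed by
the vertices of `S`, no two of which share an edge, such that adjacent vertices of `S` correspond to
intersecting subtrees. -/
theorem exists_blowup_refining {S T : GGraph G} (hS : S.IsGTree) (hT : T.IsGTree)
    (F : S.V → Set T.V) (hF : ∀ (g : G) p v, v ∈ F p → g • v ∈ F (g • p))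
    (hconv : ∀ p, IsConvex T.graph (F p)) (hne : ∀ p, (F p).Nonempty)
    (hadj : ∀ p q, S.graph.Adj p q → (F p ∩ F q).Nonempty)
    (hcov : ∀ x y, T.graph.Adj x y → ∃ p, x ∈ F p ∧ y ∈ F p)
    (huniq : ∀ x y, T.graph.Adj x y → ∀ p q, x ∈ F p → y ∈ F p → x ∈ F q → y ∈ F q → p = q) :
    ∃ R : GGraph G, R.IsGTree ∧ R.Refines S ∧ R.Refines T := by
  classical
  -- Two subtrees sharing no edge meet in at most one vertex. The attaching points are therefore
  -- canonical, which makes them symmetric and equivariant.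
  have hsub : ∀ p q, p ≠ q → ∀ v ∈ F p ∩ F q, ∀ w ∈ F p ∩ F q, v = w := by
    intro p q hpq v hv w hw
    obtain ⟨c, hc⟩ := ((hconv p).inter (hconv q)).exists_walk hT.isTree.connected hv hw
    cases c with
    | nil => rfl
    | @cons _ b _ hb c =>
      have h := hc b (by simp)
      exact absurd (huniq v b hb p q hv.1 h.1 hv.2 h.2) hpq
  obtain ⟨v₀⟩ := hT.isTree.connected.nonempty
  let a : S.V → S.V → T.V := fun p q =>
    if h : (F p ∩ F q).Nonempty then h.some else v₀
  have hamem : ∀ p q, S.graph.Adj p q → a p q ∈ F p ∩ F q := by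
    intro p q h
    simp only [a, dif_pos (hadj p q h)]
    exact (hadj p q h).some_mem
  have hasymm : ∀ p q, S.graph.Adj p q → a p q = a q p := fun p q h =>
    hsub p q h.ne _ (hamem p q h) _ (hamem q p h.symm).symm
  have ha : ∀ (g : G) p q, S.graph.Adj p q → a (g • p) (g • q) = g • a p q := by
    intro g p q h
    have h' := S.smul_adj g p q h
    exact hsub _ _ h'.ne _ (hamem _ _ h') _
      ⟨hF g _ _ (hamem p q h).1, hF g _ _ (hamem p q h).2⟩
  have hR : (blowup S T F a hF ha).IsGTree :=
    isGTree_blowup hS hT hconv hne fun p q h => (hamem p q h).1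
  refine ⟨_, hR, ⟨fun z => z.1.1, ?_⟩, ⟨fun z => z.1.2, ?_⟩⟩
  · refine isCollapseMap_of_injective hS.isTree.isAcyclic _ (fun _ _ => rfl)
      (fun p => ⟨⟨(p, _), (hne p).some_mem⟩, rfl⟩) ?_ ?_
    · rintro z w (h | h)
      exacts [Or.inl h.1, Or.inr h.1]
    · rintro ⟨⟨p, v⟩, hv⟩ ⟨⟨q, w⟩, hw⟩ ⟨⟨p', v'⟩, hv'⟩ ⟨⟨q', w'⟩, hw'⟩ h1 h2
        (hne' : p ≠ q) (heq : s(p, q) = s(p', q'))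
      obtain ⟨h1, rfl : v = a p q, rfl : w = a q p⟩ := h1.resolve_left fun h => hne' h.1
      have hne2 : p' ≠ q' := by
        rintro rfl
        rcases Sym2.eq_iff.1 heq with ⟨rfl, rfl⟩ | ⟨rfl, rfl⟩ <;> exact hne' rfl
      obtain ⟨h2, rfl : v' = a p' q', rfl : w' = a q' p'⟩ := h2.resolve_left fun h => hne2 h.1
      rcases Sym2.eq_iff.1 heq with ⟨rfl, rfl⟩ | ⟨rfl, rfl⟩
      · rfl
      · exact Sym2.eq_swap
  -- Symmetry of the attaching points makes the edges coming from `S` collapse in `T`.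
  · have hcell : ∀ z w : (blowup S T F a hF ha).V, (blowup S T F a hF ha).graph.Adj z w →
        z.1.2 = w.1.2 ∨ (z.1.1 = w.1.1 ∧ T.graph.Adj z.1.2 w.1.2) := by
      rintro z w (h | h)
      · exact Or.inr h
      · exact Or.inl (h.2.1.trans ((hasymm _ _ h.1).trans h.2.2.symm))
    refine isCollapseMap_of_injective hT.isTree.isAcyclic _ (fun _ _ => rfl)
      (fun v => ?_) (fun z w h => (hcell z w h).imp_right And.right) ?_
    · obtain ⟨p₀⟩ := hS.isTree.connected.nonempty
      obtain ⟨w, hw⟩ := hne p₀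
      obtain ⟨c⟩ := hT.isTree.connected v w
      cases c with
      | nil => exact ⟨⟨(p₀, v), hw⟩, rfl⟩
      | @cons _ b _ hb c =>
        obtain ⟨p, hp, -⟩ := hcov v b hb
        exact ⟨⟨(p, v), hp⟩, rfl⟩
    · rintro ⟨⟨p, v⟩, hv⟩ ⟨⟨q, w⟩, hw⟩ ⟨⟨p', v'⟩, hv'⟩ ⟨⟨q', w'⟩, hw'⟩ h1 h2
        (hne' : v ≠ w) (heq : s(v, w) = s(v', w'))
      obtain ⟨rfl : p = q, h1 : T.graph.Adj v w⟩ := (hcell _ _ h1).resolve_left hne'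
      have hne2 : v' ≠ w' := by
        rintro rfl
        rcases Sym2.eq_iff.1 heq with ⟨rfl, rfl⟩ | ⟨rfl, rfl⟩ <;> exact hne' rfl
      obtain ⟨rfl : p' = q', h2 : T.graph.Adj v' w'⟩ := (hcell _ _ h2).resolve_left hne2
      rcases Sym2.eq_iff.1 heq with ⟨rfl, rfl⟩ | ⟨rfl, rfl⟩
      · obtain rfl := huniq v w h1 p p' hv hw hv' hw'
        rfl
      · obtain rfl := huniq v w h1 p p' hv hw hw' hv'
        exact Sym2.eq_swap

/-! ### Cylinders and the tree of cylinders -/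

section TreeOfCylinders

variable {𝓔 𝓗 : Set (Subgroup G)} {r : Subgroup G → Subgroup G → Prop}

theorem isCylinder_cylinder {T : GGraph G} {e : Sym2 T.V} (he : e ∈ T.edges) :
    T.IsCylinder r (T.cylinder r e) := ⟨e, he, rfl⟩

theorem mem_cylinder_self (hr : IsAdmissible 𝓔 𝓗 r) {T : GGraph G} (hT : T.IsETree 𝓔 𝓗)
    {e : Sym2 T.V} (he : e ∈ T.edges) : e ∈ T.cylinder r e :=
  ⟨he, hr.refl _ (hT.edgeStab_mem e he)⟩

theorem IsCylinder.mem_edges {T : GGraph G} {Y : Set (Sym2 T.V)} (hY : T.IsCylinder r Y)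
    {e : Sym2 T.V} (he : e ∈ Y) : e ∈ T.edges := by
  obtain ⟨e', -, rfl⟩ := hY
  exact he.1

theorem IsCylinder.rel (hr : IsAdmissible 𝓔 𝓗 r) {T : GGraph G} (hT : T.IsETree 𝓔 𝓗)
    {Y : Set (Sym2 T.V)} (hY : T.IsCylinder r Y) {e e' : Sym2 T.V} (he : e ∈ Y) (he' : e' ∈ Y) :
    r (T.edgeStab e) (T.edgeStab e') := by
  obtain ⟨e₀, he₀, rfl⟩ := hY
  have h0 := hT.edgeStab_mem _ he₀
  have h := hT.edgeStab_mem _ he.1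
  exact hr.trans _ h _ h0 _ (hT.edgeStab_mem _ he'.1) (hr.symm _ h0 _ h he.2) he'.2

theorem IsCylinder.mem_of_rel (hr : IsAdmissible 𝓔 𝓗 r) {T : GGraph G} (hT : T.IsETree 𝓔 𝓗)
    {Y : Set (Sym2 T.V)} (hY : T.IsCylinder r Y) {e e' : Sym2 T.V} (he : e ∈ Y)
    (he' : e' ∈ T.edges) (h : r (T.edgeStab e) (T.edgeStab e')) : e' ∈ Y := by
  obtain ⟨e₀, he₀, rfl⟩ := hY
  exact ⟨he', hr.trans _ (hT.edgeStab_mem _ he₀) _ (hT.edgeStab_mem _ he.1) _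
    (hT.edgeStab_mem _ he') he.2 h⟩

theorem IsCylinder.eq (hr : IsAdmissible 𝓔 𝓗 r) {T : GGraph G} (hT : T.IsETree 𝓔 𝓗)
    {Y Y' : Set (Sym2 T.V)} (hY : T.IsCylinder r Y) (hY' : T.IsCylinder r Y') {e : Sym2 T.V}
    (he : e ∈ Y) (he' : e ∈ Y') : Y = Y' := by
  ext e'
  exact ⟨fun h => hY'.mem_of_rel hr hT he' (hY.mem_edges h) (hY.rel hr hT he h),
    fun h => hY.mem_of_rel hr hT he (hY'.mem_edges h) (hY'.rel hr hT he' h)⟩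

theorem edgeInSegment_mem_edges {T : GGraph G} {e : Sym2 T.V} {a b : T.V}
    (h : T.EdgeInSegment e a b) : e ∈ T.edges := by
  obtain ⟨p, -, he⟩ := h
  exact p.edges_subset_edgeSet he

/-- Edge stabilizers fix the endpoints of their edges, so the segment axiom of admissibility applies
in `T` itself. -/
theorem IsCylinder.mem_of_edgeInSegment (hr : IsAdmissible 𝓔 𝓗 r) {T : GGraph G}
    (hT : T.IsETree 𝓔 𝓗) {Y : Set (Sym2 T.V)} (hY : T.IsCylinder r Y) {a b : T.V}
    (ha : T.MemCylinder a Y) (hb : T.MemCylinder b Y) {e : Sym2 T.V}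
    (h : T.EdgeInSegment e a b) : e ∈ Y := by
  obtain ⟨e₁, he₁, ha⟩ := ha
  obtain ⟨e₂, he₂, hb⟩ := hb
  have h1 := hT.edgeStab_mem _ (hY.mem_edges he₁)
  have h2 := hT.edgeStab_mem _ (hY.mem_edges he₂)
  have he := edgeInSegment_mem_edges h
  exact hY.mem_of_rel hr hT he₁ he (hr.symm _ (hT.edgeStab_mem _ he) _ h1
    (hr.segment T hT _ h1 _ h2 (hY.rel hr hT he₁ he₂) a b
    (hT.isGTree.fixes_of_mem (hY.mem_edges he₁) ha)
    (hT.isGTree.fixes_of_mem (hY.mem_edges he₂) hb) e h).1)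

theorem IsCylinder.isConvex (hr : IsAdmissible 𝓔 𝓗 r) {T : GGraph G}
    (hT : T.IsETree 𝓔 𝓗) {Y : Set (Sym2 T.V)} (hY : T.IsCylinder r Y) :
    IsConvex T.graph {x | T.MemCylinder x Y} := by
  intro a ha b hb p hp x hx
  rcases exists_edge_of_mem_support p hx with rfl | ⟨e, he, hxe⟩
  · exact ha
  · exact ⟨e, hY.mem_of_edgeInSegment hr hT ha hb ⟨p, hp, he⟩, hxe⟩

theorem IsCylinder.mk_mem (hr : IsAdmissible 𝓔 𝓗 r) {T : GGraph G}
    (hT : T.IsETree 𝓔 𝓗) {Y : Set (Sym2 T.V)} (hY : T.IsCylinder r Y) {a b : T.V}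
    (hab : T.graph.Adj a b) (ha : T.MemCylinder a Y) (hb : T.MemCylinder b Y) : s(a, b) ∈ Y :=
  hY.mem_of_edgeInSegment hr hT ha hb (edgeInSegment_of_adj hab)

theorem IsCylinder.exists_memCylinder (hr : IsAdmissible 𝓔 𝓗 r) {T : GGraph G}
    (hT : T.IsETree 𝓔 𝓗) {Y : Set (Sym2 T.V)} (hY : T.IsCylinder r Y) :
    ∃ x, T.MemCylinder x Y := by
  obtain ⟨e, he, rfl⟩ := hY
  have := mem_cylinder_self hr hT he
  induction e using Sym2.ind with
  | _ a b => exact ⟨a, _, this, by simp⟩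

/-- The bipartite incidence graph of all the vertices of `T` and all its cylinders. -/
def fullTreeOfCylinders (hr : IsAdmissible 𝓔 𝓗 r) {T : GGraph G} (hT : T.IsETree 𝓔 𝓗) :
    GGraph G where
  V := T.V ⊕ V₁ hr hT
  act :=
    { smul := fun g z => Sum.map (fun x => g • x) (fun Y => g • Y) z
      one_smul := by
        rintro (x | Y)
        · exact congrArg Sum.inl (one_smul G x)
        · exact congrArg Sum.inr (one_smul G Y)
      mul_smul := by
        rintro g h (x | Y)
        · exact congrArg Sum.inl (mul_smul g h x)
        · exact congrArg Sum.inr (mul_smul g h Y) }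
  graph :=
    { Adj := fun z z' =>
        match z, z' with
        | Sum.inl x, Sum.inr Y => T.MemCylinder x Y.1
        | Sum.inr Y, Sum.inl x => T.MemCylinder x Y.1
        | _, _ => False
      symm := ⟨by rintro (x | Y) (x' | Y') h <;> exact h⟩
      loopless := ⟨by rintro (x | Y) h <;> exact h⟩ }
  smul_adj := by
    rintro g (x | Y) (x' | Y') h
    · exact h
    · exact T.memCylinder_smul g h
    · exact T.memCylinder_smul g h
    · exact h

variable (hr : IsAdmissible 𝓔 𝓗 r) {T : GGraph G} (hT : T.IsETree 𝓔 𝓗)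

theorem fullTreeOfCylinders_connected : (fullTreeOfCylinders hr hT).graph.Connected := by
  obtain ⟨x₀⟩ := hT.isGTree.isTree.connected.nonempty
  have hx : ∀ x y : T.V, (fullTreeOfCylinders hr hT).graph.Reachable (Sum.inl x) (Sum.inl y) := by
    intro x y
    obtain ⟨p⟩ := hT.isGTree.isTree.connected x y
    induction p with
    | nil => exact SimpleGraph.Reachable.refl _
    | @cons a b _ hab p ih =>
      let Y : V₁ hr hT := ⟨T.cylinder r s(a, b), isCylinder_cylinder hab⟩
      have hY := mem_cylinder_self hr hT (show s(a, b) ∈ T.edges from hab)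
      have h1 : (fullTreeOfCylinders hr hT).graph.Adj (Sum.inl a) (Sum.inr Y) :=
        ⟨_, hY, by simp⟩
      have h2 : (fullTreeOfCylinders hr hT).graph.Adj (Sum.inr Y) (Sum.inl b) :=
        ⟨_, hY, by simp⟩
      exact (h1.reachable.trans h2.reachable).trans ih
  have h0 : ∀ z, (fullTreeOfCylinders hr hT).graph.Reachable (Sum.inl x₀) z := by
    rintro (x | Y)
    · exact hx x₀ x
    · obtain ⟨x, hxY⟩ := IsCylinder.exists_memCylinder hr hT Y.2
      have h1 : (fullTreeOfCylinders hr hT).graph.Adj (Sum.inl x) (Sum.inr Y) := hxY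
      exact (hx x₀ x).trans h1.reachable
  have : Nonempty (fullTreeOfCylinders hr hT).V := ⟨Sum.inl x₀⟩
  exact ⟨fun z w => (h0 z).symm.trans (h0 w)⟩

theorem fullTreeOfCylinders_exists_cut (x : T.V) (Y : V₁ hr hT) (hxY : T.MemCylinder x Y.1) :
    ∃ S, IsCut (fullTreeOfCylinders hr hT).graph (Sum.inl x) (Sum.inr Y) S := by
  have hconv := IsCylinder.isConvex hr hT Y.2
  obtain ⟨π, hπ⟩ := exists_projection hT.isGTree.isTree hconv ⟨x, hxY⟩
  -- Another cylinder shares no edge with `Y`, so it projects to a single vertex of `Y`. The side of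
  -- `x` is what projects to `x`.
  have hconst : ∀ Y' : V₁ hr hT, Y' ≠ Y → ∀ z, T.MemCylinder z Y'.1 →
      ∀ z', T.MemCylinder z' Y'.1 → π z = π z' := by
    intro Y' hne z hz z' hz'
    obtain ⟨p, hp⟩ := (IsCylinder.isConvex hr hT Y'.2).exists_walk
      hT.isGTree.isTree.connected hz hz'
    induction p with
    | nil => rfl
    | @cons a b _ hab p ih =>
      have hb : T.MemCylinder b Y'.1 := hp b (by simp)
      refine (hπ.eq_of_adj a b hab fun h => hne (Subtype.ext ?_)).trans
        (ih hb hz' fun x hx => hp x (by simp [hx]))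
      exact IsCylinder.eq hr hT Y'.2 Y.2 (IsCylinder.mk_mem hr hT Y'.2 hab hz hb)
        (IsCylinder.mk_mem hr hT Y.2 hab h.1 h.2)
  refine ⟨{z | match z with
    | Sum.inl z => π z = x
    | Sum.inr Y' => Y' ≠ Y ∧ ∃ z, T.MemCylinder z Y'.1 ∧ π z = x}, hπ.eq_self x hxY,
    fun h => h.1 rfl, ?_⟩
  rintro (z | Y') (z' | Y'') h h1 h2
  · exact h.elim
  · have h3 : π z = x := h1
    have hY : Y'' = Y := by
      by_contra hne
      exact h2 ⟨hne, z, h, h3⟩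
    subst hY
    exact ⟨congrArg Sum.inl ((hπ.eq_self z h).symm.trans h3), rfl⟩
  · obtain ⟨hne, z, hz, hzx⟩ := h1
    exact absurd ((hconst Y' hne z' h z hz).trans hzx) h2
  · exact h.elim

theorem isGTree_fullTreeOfCylinders : (fullTreeOfCylinders hr hT).IsGTree where
  isTree := by
    refine isTree_of_cuts (fullTreeOfCylinders_connected hr hT) ?_
    rintro (x | Y) (x' | Y') h
    · exact h.elim
    · exact fullTreeOfCylinders_exists_cut hr hT x Y' h
    · obtain ⟨S, hS⟩ := fullTreeOfCylinders_exists_cut hr hT x' Y h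
      exact ⟨_, hS.compl⟩
    · exact h.elim
  no_inversion := by
    rintro g (x | Y) (x' | Y') h ⟨h1, -⟩
    · exact h
    · exact Sum.inl_ne_inr h1
    · exact Sum.inr_ne_inl h1
    · exact h

/-- The inclusion of the vertices of the tree of cylinders. -/
def inclFull : (treeOfCylinders hr hT).V → (fullTreeOfCylinders hr hT).V :=
  Sum.map Subtype.val id

theorem inclFull_injective : Function.Injective (inclFull hr hT) :=
  Sum.map_injective.2 ⟨Subtype.val_injective, Function.injective_id⟩

theorem inclFull_adj (z w : (treeOfCylinders hr hT).V) :
    (fullTreeOfCylinders hr hT).graph.Adj (inclFull hr hT z) (inclFull hr hT w) ↔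
      (treeOfCylinders hr hT).graph.Adj z w := by
  rcases z with z | z <;> rcases w with w | w <;> exact Iff.rfl

theorem exists_memCylinder_of_edges_nonempty (h : T.edges ≠ ∅) (x : T.V) :
    ∃ Y : V₁ hr hT, T.MemCylinder x Y.1 := by
  obtain ⟨e, he⟩ := Set.nonempty_iff_ne_empty.2 h
  obtain ⟨y, hxy⟩ : ∃ y, x ≠ y := by
    induction e using Sym2.ind with
    | _ a b =>
      by_cases hxa : x = a
      · exact ⟨b, fun hb => T.graph.ne_of_adj he (hxa.symm.trans hb)⟩
      · exact ⟨a, hxa⟩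
  obtain ⟨p⟩ := hT.isGTree.isTree.connected x y
  cases p with
  | nil => exact absurd rfl hxy
  | @cons _ b _ hab p =>
    exact ⟨⟨T.cylinder r s(x, b), isCylinder_cylinder hab⟩, _,
      mem_cylinder_self hr hT hab, by simp⟩

/-- Collapsing the terminal vertices of the full tree of cylinders. -/
theorem exists_fullTreeOfCylinders_retraction :
    ∃ κ : (fullTreeOfCylinders hr hT).V → (treeOfCylinders hr hT).V,
      (∀ (g : G) z, κ (g • z) = g • κ z) ∧ (∀ z, κ (inclFull hr hT z) = z) ∧
      ∀ z w, (fullTreeOfCylinders hr hT).graph.Adj z w → κ z ≠ κ w →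
        inclFull hr hT (κ z) = z ∧ inclFull hr hT (κ w) = w := by
  -- A vertex outside `V₀` lies in exactly one cylinder and is retracted to it; everything else
  -- stays put.
  let P : (fullTreeOfCylinders hr hT).V → (treeOfCylinders hr hT).V → Prop := fun z t =>
    match z, t with
    | Sum.inl x, Sum.inl x' => x = x'.1
    | Sum.inl x, Sum.inr Y => x ∉ V₀ hr hT ∧ T.MemCylinder x Y.1
    | Sum.inr Y, Sum.inr Y' => Y = Y'
    | Sum.inr _, Sum.inl _ => False
  have hex : ∀ z, ∃ t, P z t := by
    rintro (x | Y)
    · by_cases hx : x ∈ V₀ hr hT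
      · exact ⟨Sum.inl ⟨x, hx⟩, rfl⟩
      -- By the convention for a one-point tree, a vertex outside `V₀` can occur only when there are
      -- edges.
      · obtain ⟨Y, hY⟩ := exists_memCylinder_of_edges_nonempty hr hT (fun h => hx (Or.inr h)) x
        exact ⟨Sum.inr Y, hx, hY⟩
    · exact ⟨Sum.inr Y, rfl⟩
  have huniq : ∀ z t t', P z t → P z t' → t = t' := by
    rintro (x | Y) (x' | Y') (x'' | Y'') h h'
    · exact congrArg Sum.inl (Subtype.ext (Eq.trans (Eq.symm h) h'))
    · exact absurd (by rw [show x = x'.1 from h]; exact x'.2) h'.1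
    · exact absurd (by rw [show x = x''.1 from h']; exact x''.2) h.1
    · refine congrArg Sum.inr (Subtype.ext ?_)
      by_contra hne
      exact h.1 (Or.inl ⟨_, _, Y'.2, Y''.2, hne, h.2, h'.2⟩)
    · exact h.elim
    · exact h.elim
    · exact h'.elim
    · exact congrArg Sum.inr (Eq.trans (Eq.symm h) h')
  have hsmul : ∀ (g : G) z t, P z t → P (g • z) (g • t) := by
    rintro g (x | Y) (x' | Y') h
    · exact congrArg (g • ·) h
    · refine ⟨fun hx => h.1 ?_, T.memCylinder_smul g h.2⟩
      have := (V₀ hr hT).smul_mem g⁻¹ hx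
      rwa [inv_smul_smul] at this
    · exact h
    · exact congrArg (g • ·) h
  choose κ hκ using hex
  have hκ' : ∀ z t, P z t → κ z = t := fun z t h => huniq z _ _ (hκ z) h
  refine ⟨κ, fun g z => hκ' _ _ (hsmul g _ _ (hκ z)), ?_, ?_⟩
  · rintro (x | Y)
    · exact hκ' _ _ rfl
    · exact hκ' _ _ rfl
  · have key : ∀ (x : T.V) (Y : V₁ hr hT), T.MemCylinder x Y.1 →
        κ (Sum.inl x) ≠ κ (Sum.inr Y) → inclFull hr hT (κ (Sum.inl x)) = Sum.inl x ∧
          inclFull hr hT (κ (Sum.inr Y)) = Sum.inr Y := by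
      intro x Y hxY hne
      have hY : κ (Sum.inr Y) = Sum.inr Y := hκ' _ _ rfl
      have hx : x ∈ V₀ hr hT := by
        by_contra hx
        exact hne ((hκ' (Sum.inl x) (Sum.inr Y) ⟨hx, hxY⟩).trans hY.symm)
      have hx' : κ (Sum.inl x) = Sum.inl ⟨x, hx⟩ := hκ' _ _ rfl
      rw [hY, hx']
      exact ⟨rfl, rfl⟩
    rintro (x | Y) (x' | Y') h hne
    · exact h.elim
    · exact key x Y' h hne
    · exact (key x' Y h hne.symm).symm
    · exact h.elim

/-- The retraction turns walks of the full tree into walks here, giving connectedness; acyclicity is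
inherited from the full tree. -/
theorem isGTree_treeOfCylinders : (treeOfCylinders hr hT).IsGTree where
  isTree := by
    obtain ⟨κ, -, hκ, hadj⟩ := exists_fullTreeOfCylinders_retraction hr hT
    have hfull := (isGTree_fullTreeOfCylinders hr hT).isTree
    constructor
    · have : Nonempty (treeOfCylinders hr hT).V := hfull.connected.nonempty.map κ
      refine ⟨fun z w => ?_⟩
      rw [← hκ z, ← hκ w]
      obtain ⟨p⟩ := hfull.connected (inclFull hr hT z) (inclFull hr hT w)
      generalize inclFull hr hT z = a, inclFull hr hT w = b at p
      induction p with
      | nil => exact SimpleGraph.Reachable.refl _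
      | @cons a b _ hab p ih =>
        refine SimpleGraph.Reachable.trans ?_ ih
        by_cases hne : κ a = κ b
        · rw [hne]
        · obtain ⟨h1, h2⟩ := hadj a b hab hne
          refine SimpleGraph.Adj.reachable ((inclFull_adj hr hT _ _).1 ?_)
          rwa [h1, h2]
    · exact hfull.isAcyclic.comap ⟨inclFull hr hT, fun {z w} h => (inclFull_adj hr hT z w).2 h⟩
        (inclFull_injective hr hT)
  no_inversion := by
    rintro g (x | Y) (x' | Y') h ⟨h1, -⟩
    · exact h
    · exact Sum.inl_ne_inr h1
    · exact Sum.inr_ne_inl h1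
    · exact h

theorem fullTreeOfCylinders_refines :
    (fullTreeOfCylinders hr hT).Refines (treeOfCylinders hr hT) := by
  obtain ⟨κ, hsmul, hκ, hadj⟩ := exists_fullTreeOfCylinders_retraction hr hT
  refine ⟨κ, isCollapseMap_of_injective (isGTree_treeOfCylinders hr hT).isTree.isAcyclic κ hsmul
    (fun z => ⟨_, hκ z⟩) (fun z w hzw => ?_) fun z w z' w' hzw hzw' hne heq => ?_⟩
  · by_cases hne : κ z = κ w
    · exact Or.inl hne
    · obtain ⟨h1, h2⟩ := hadj z w hzw hne
      refine Or.inr ((inclFull_adj hr hT _ _).1 ?_)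
      rwa [h1, h2]
  · have hne' : κ z' ≠ κ w' := by
      intro h
      rw [h] at heq
      rcases Sym2.eq_iff.1 heq with h | h
      · exact hne (h.1.trans h.2.symm)
      · exact hne (h.1.trans h.2.symm)
    obtain ⟨h1, h2⟩ := hadj z w hzw hne
    obtain ⟨h3, h4⟩ := hadj z' w' hzw' hne'
    have := congrArg (Sym2.map (inclFull hr hT)) heq
    simp only [Sym2.map_mk] at this
    rwa [h1, h2, h3, h4] at this

end TreeOfCylinders

/-! ### Blowing up the JSJ tree -/

/-- The edges of `T` with universally elliptic stabilizer. -/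
def ueEdges (𝓔 𝓗 : Set (Subgroup G)) (T : GGraph G) : Set (Sym2 T.V) :=
  {e | e ∈ T.edges ∧ UniversallyElliptic 𝓔 𝓗 (T.edgeStab e)}

theorem smul_mem_ueEdges {𝓔 𝓗 : Set (Subgroup G)} (T : GGraph G) (g : G) (e : Sym2 T.V)
    (he : e ∈ T.ueEdges 𝓔 𝓗) : g • e ∈ T.ueEdges 𝓔 𝓗 := by
  refine ⟨T.smul_mem_edges g he.1, ?_⟩
  rw [edgeStab_smul]
  exact fun T' hT' => (he.2 T' hT').conj g

theorem isUniversallyEllipticTree_collapse {𝓔 𝓗 : Set (Subgroup G)} {T : GGraph G}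
    (hT : T.IsETree 𝓔 𝓗) :
    IsUniversallyEllipticTree 𝓔 𝓗 (T.collapse (T.ueEdges 𝓔 𝓗) T.smul_mem_ueEdges) where
  isETree :=
    { isGTree := isGTree_collapse hT.isGTree
      edgeStab_mem := fun e he => by
        obtain ⟨x, y, hxy, hK, rfl⟩ := exists_of_mem_collapse_edges he
        rw [collapse_edgeStab hT.isGTree.isTree.isAcyclic hxy hK]
        exact hT.edgeStab_mem _ hxy
      elliptic := fun H hH => (hT.elliptic H hH).map _ toCollapse_smul }
  edgeStab_ue := fun e he => by
    obtain ⟨x, y, hxy, hK, rfl⟩ := exists_of_mem_collapse_edges he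
    rw [collapse_edgeStab hT.isGTree.isTree.isAcyclic hxy hK]
    exact hK.2

/-- The vertices of a JSJ tree can be blown up to subtrees of any given `𝓔`-tree whose edge
stabilizers are not universally elliptic. -/
theorem exists_blowup_data {𝓔 𝓗 : Set (Subgroup G)} {J T : GGraph G} (hJ : IsJSJTree 𝓔 𝓗 J)
    (hT : T.IsETree 𝓔 𝓗) :
    ∃ (P : J.V → Set T.V) (a : J.V → J.V → T.V),
      (∀ (g : G) p v, v ∈ P p → g • v ∈ P (g • p)) ∧
      (∀ (g : G) p q, J.graph.Adj p q → a (g • p) (g • q) = g • a p q) ∧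
      (∀ p, IsConvex T.graph (P p)) ∧ (∀ p, (P p).Nonempty) ∧
      (∀ p q, J.graph.Adj p q → a p q ∈ P p) ∧
      ∀ p v w, v ∈ P p → w ∈ P p → T.graph.Adj v w → s(v, w) ∉ T.ueEdges 𝓔 𝓗 := by
  have hTt := hT.isGTree.isTree
  obtain ⟨f, hf⟩ := hJ.maximal _ (isUniversallyEllipticTree_collapse hT)
  let P : J.V → Set T.V := fun p =>
    {v | T.toCollapse (T.ueEdges 𝓔 𝓗) T.smul_mem_ueEdges v = f p}
  have hP : ∀ (g : G) p v, v ∈ P p → g • v ∈ P (g • p) := by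
    intro g p v hv
    change T.toCollapse (T.ueEdges 𝓔 𝓗) T.smul_mem_ueEdges (g • v) = f (g • p)
    rw [toCollapse_smul, hf]
    exact congrArg (g • ·) hv
  have hconv : ∀ p, IsConvex T.graph (P p) := fun p =>
    isConvex_toCollapse_fiber hTt.isAcyclic (f p)
  have hne : ∀ p, (P p).Nonempty := fun p => toCollapse_surjective (f p)
  obtain ⟨v₀⟩ := hTt.connected.nonempty
  have : Nonempty T.V := ⟨v₀⟩
  -- The stabilizer of an oriented edge lies in a universally elliptic edge stabilizer, so it fixes
  -- a vertex of `T`, which is then moved into the invariant subtree `P p` by projection.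
  obtain ⟨a, ha, ha'⟩ := exists_equivariant_choice (G := G) (X := J.V × J.V) (V := T.V)
    (fun x => J.graph.Adj x.1 x.2) (fun x v => v ∈ P x.1)
    (fun g x hx => J.smul_adj g _ _ hx) (fun g x v hv => hP g _ _ hv) (by
      rintro ⟨p, q⟩ hpq
      let A : Subgroup G := MulAction.stabilizer G (p, q)
      have hA : ∀ g ∈ A, g • p = p ∧ g • q = q := fun g hg =>
        ⟨congrArg Prod.fst (show g • (p, q) = (p, q) from hg),
          congrArg Prod.snd (show g • (p, q) = (p, q) from hg)⟩
      obtain ⟨v, hv, hfix⟩ := exists_fixes_mem hTt (hconv p) (hne p) (A := A)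
        (fun g hg x hx => by
          have := hP g p x hx
          rwa [(hA g hg).1] at this)
        ((hJ.isUE.edgeStab_ue _ hpq T hT).mono fun g hg =>
          mem_edgeStab_of_fixed (hA g hg).1 (hA g hg).2)
      exact ⟨v, hv, fun g hg => hfix g hg⟩)
  refine ⟨P, fun p q => a (p, q), hP, fun g p q h => ha' g (p, q) h, hconv, hne,
    fun p q h => ha (p, q) h, fun p v w hv hw hvw he => ?_⟩
  exact toCollapse_ne (hK := T.smul_mem_ueEdges) hTt.isAcyclic hvw he (Eq.trans hv hw.symm)

section Restrict

variable {J T : GGraph G} {P : J.V → Set T.V} {a : J.V → J.V → T.V}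
  {hP : ∀ (g : G) p v, v ∈ P p → g • v ∈ P (g • p)}
  {ha : ∀ (g : G) p q, J.graph.Adj p q → a (g • p) (g • q) = g • a p q}

theorem blowup_fixed {z w : (blowup J T P a hP ha).V} (hadj : J.graph.Adj z.1.1 w.1.1)
    (hz : z.1.2 = a z.1.1 w.1.1) {g : G} (h1 : g • z.1.1 = z.1.1) (h2 : g • w.1.1 = w.1.1) :
    g • z = z := by
  refine Subtype.ext (Prod.ext h1 ?_)
  change g • z.1.2 = z.1.2
  rw [hz, ← ha g _ _ hadj, h1, h2]

variable {M : Set (blowup J T P a hP ha).V} {hM : ∀ (g : G), ∀ x ∈ M, g • x ∈ M}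

theorem restrict_blowup_edgeStab (hJ : J.IsGTree)
    {z w : ((blowup J T P a hP ha).restrict M hM).V} (hadj : J.graph.Adj z.1.1.1 w.1.1.1)
    (hz : z.1.1.2 = a z.1.1.1 w.1.1.1) (hw : w.1.1.2 = a w.1.1.1 z.1.1.1) :
    ((blowup J T P a hP ha).restrict M hM).edgeStab s(z, w) =
      J.edgeStab s(z.1.1.1, w.1.1.1) := by
  refine le_antisymm (edgeStab_le_map
    (fun z : ((blowup J T P a hP ha).restrict M hM).V => z.1.1.1) (fun _ _ => rfl) z w) ?_
  intro g hg
  obtain ⟨h1, h2⟩ := (hJ.mem_edgeStab hadj).1 hg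
  exact mem_edgeStab_of_fixed (Subtype.ext (blowup_fixed hadj hz h1 h2))
    (Subtype.ext (blowup_fixed hadj.symm hw h2 h1))

theorem restrict_blowup_edgeStab_le (z w : ((blowup J T P a hP ha).restrict M hM).V) :
    ((blowup J T P a hP ha).restrict M hM).edgeStab s(z, w) ≤ T.edgeStab s(z.1.1.2, w.1.1.2) :=
  edgeStab_le_map
    (fun z : ((blowup J T P a hP ha).restrict M hM).V => z.1.1.2) (fun _ _ => rfl) z w

/-- Edges from `J` keep their stabilizers. A fibre edge only has a stabilizer contained in a group
of `𝓔`, but by minimality `G` splits over it relative to `𝓗`, and substability applies. -/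
theorem isETree_restrict_blowup {𝓔 𝓗 : Set (Subgroup G)} (hsub : IsSubstable 𝓔 𝓗)
    (hJ : J.IsETree 𝓔 𝓗) (hT : T.IsETree 𝓔 𝓗) (hX : (blowup J T P a hP ha).IsGTree)
    (hconv : ∀ p, IsConvex T.graph (P p)) (hne : ∀ p, (P p).Nonempty)
    (hMconv : IsConvex (blowup J T P a hP ha).graph M) (hMne : M.Nonempty)
    (hmin : ((blowup J T P a hP ha).restrict M hM).IsMinimal) :
    ((blowup J T P a hP ha).restrict M hM).IsETree 𝓔 𝓗 := by
  have hMt := isGTree_restrict (hC := hM) hX hMconv hMne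
  have hell : ∀ H ∈ 𝓗, ((blowup J T P a hP ha).restrict M hM).Elliptic H := by
    intro H hH
    obtain ⟨p, hp⟩ := hJ.elliptic H hH
    obtain ⟨v, hv, hfix⟩ := exists_fixes_mem hT.isGTree.isTree (hconv p) (hne p) (A := H)
      (fun g hg x hx => by
        have := hP g p x hx
        rwa [hp g hg] at this) (hT.elliptic H hH)
    obtain ⟨m, hm, hfix'⟩ := exists_fixes_mem hX.isTree hMconv hMne (A := H)
      (fun g _ x hx => hM g x hx)
      ⟨⟨(p, v), hv⟩, fun g hg => Subtype.ext (Prod.ext (hp g hg) (hfix g hg))⟩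
    exact ⟨⟨m, hm⟩, fun g hg => Subtype.ext (hfix' g hg)⟩
  refine ⟨hMt, fun e he => ?_, hell⟩
  induction e using Sym2.ind with
  | _ z w =>
    have hadj : ((blowup J T P a hP ha).restrict M hM).graph.Adj z w := he
    rcases hadj with h | h
    · exact hsub _ (splitsOver_edgeStab hMt hmin hell he) _ (hT.edgeStab_mem _ h.2)
        (restrict_blowup_edgeStab_le z w)
    · rw [restrict_blowup_edgeStab hJ.isGTree h.1 h.2.1 h.2.2]
      exact hJ.edgeStab_mem _ h.1

/-- An edge of `T` with non universally elliptic stabilizer cannot be lifted to two distinct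
vertex fibres of a blow-up which is an `𝓔`-tree. -/
theorem eq_of_restrict_blowup {𝓔 𝓗 : Set (Subgroup G)} {r : Subgroup G → Subgroup G → Prop}
    (hr : IsAdmissible 𝓔 𝓗 r) (hUE : PreservesUniversalEllipticity 𝓔 𝓗 r)
    (hJ : IsUniversallyEllipticTree 𝓔 𝓗 J) (hT : T.IsETree 𝓔 𝓗)
    (hMt : ((blowup J T P a hP ha).restrict M hM).IsETree 𝓔 𝓗)
    {v w : T.V} (hvw : T.graph.Adj v w) (he : s(v, w) ∉ T.ueEdges 𝓔 𝓗)
    {z₁ z₂ z₁' z₂' : ((blowup J T P a hP ha).restrict M hM).V}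
    (h₁ : z₁.1.1.1 = z₂.1.1.1) (h₁' : z₁'.1.1.1 = z₂'.1.1.1)
    (hv : z₁.1.1.2 = v) (hw : z₂.1.1.2 = w) (hv' : z₁'.1.1.2 = v) (hw' : z₂'.1.1.2 = w) :
    z₁.1.1.1 = z₁'.1.1.1 := by
  subst hv hw
  by_contra hne
  have hadj : ((blowup J T P a hP ha).restrict M hM).graph.Adj z₁ z₂ := Or.inl ⟨h₁, hvw⟩
  have hvw' : T.graph.Adj z₁'.1.1.2 z₂'.1.1.2 := by rw [hv', hw']; exact hvw
  have hadj' : ((blowup J T P a hP ha).restrict M hM).graph.Adj z₁' z₂' :=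
    Or.inl ⟨h₁', hvw'⟩
  have hA := hMt.edgeStab_mem s(z₁, z₂) hadj
  have hA' := hMt.edgeStab_mem s(z₁', z₂') hadj'
  have hB := hT.edgeStab_mem s(z₁.1.1.2, z₂.1.1.2) hvw
  -- Both lifts have stabilizers in `𝓔` contained in that of `vw`, so the three groups are
  -- equivalent.
  have hAB := hr.incl _ hA _ hB (restrict_blowup_edgeStab_le z₁ z₂)
  have hAB' := hr.incl _ hA' _ hB (by
    have := restrict_blowup_edgeStab_le z₁' z₂'
    rwa [hv', hw'] at this)
  have hAA' := hr.trans _ hA _ hB _ hA' hAB (hr.symm _ hA' _ hB hAB')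
  obtain ⟨p, hp⟩ := exists_path hMt.isGTree.isTree.connected z₁ z₁'
  obtain ⟨d, hd, hd1, hd2⟩ := p.exists_boundary_dart {t | t.1.1.1 = z₁.1.1.1} rfl
    (fun h => hne (Eq.symm h))
  have hdadj := d.adj
  rcases hdadj with h | h
  · exact hd2 (h.1.symm.trans hd1)
  -- The path between the lifts leaves its fibre across an edge of `J`. Its stabilizer is
  -- universally elliptic and equivalent to that of the lift, hence that of `vw` would be
  -- universally elliptic too.
  · have hseg := (hr.segment _ hMt _ hA _ hA' hAA' z₁ z₁'
      (hMt.isGTree.fixes_of_mem hadj (by simp)) (hMt.isGTree.fixes_of_mem hadj' (by simp))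
      s(d.fst, d.snd) ⟨p, hp, List.mem_map_of_mem (f := SimpleGraph.Dart.edge) hd⟩).1
    rw [restrict_blowup_edgeStab hJ.isETree.isGTree h.1 h.2.1 h.2.2] at hseg
    have hE := hJ.isETree.edgeStab_mem s(d.fst.1.1.1, d.snd.1.1.1) h.1
    have hue := (hUE _ hE _ hA hseg).1 (hJ.edgeStab_ue s(d.fst.1.1.1, d.snd.1.1.1) h.1)
    exact he ⟨hvw, (hUE _ hA _ hB hAB).1 hue⟩

end Restrict

/-- The family of subtrees of an `𝓔`-tree `T` associated to the vertices of a JSJ tree. -/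
theorem exists_vertex_family [Group.FG G] {𝓔 𝓗 : Set (Subgroup G)}
    {r : Subgroup G → Subgroup G → Prop} (hr : IsAdmissible 𝓔 𝓗 r) (hsub : IsSubstable 𝓔 𝓗)
    (hUE : PreservesUniversalEllipticity 𝓔 𝓗 r) {J T : GGraph G} (hJ : IsJSJTree 𝓔 𝓗 J)
    (hT : T.IsETree 𝓔 𝓗) (hTmin : T.IsMinimal) :
    ∃ F : J.V → Set T.V, (∀ (g : G) p v, v ∈ F p → g • v ∈ F (g • p)) ∧
      (∀ p, IsConvex T.graph (F p)) ∧ (∀ p, (F p).Nonempty) ∧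
      (∀ p q, J.graph.Adj p q → ∃ v ∈ F p, T.Fixes (J.edgeStab s(p, q)) v) ∧
      (∀ p v w, v ∈ F p → w ∈ F p → T.graph.Adj v w → s(v, w) ∉ T.ueEdges 𝓔 𝓗) ∧
      (∀ p q v w, T.graph.Adj v w → v ∈ F p → w ∈ F p → v ∈ F q → w ∈ F q → p = q) ∧
      ∀ v w, T.graph.Adj v w → (∃ p, v ∈ F p ∧ w ∈ F p) ∨
        ∃ p q, J.graph.Adj p q ∧ J.edgeStab s(p, q) ≤ T.edgeStab s(v, w) := by
  have hTt := hT.isGTree.isTree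
  have hJt := hJ.isUE.isETree.isGTree
  obtain ⟨P, a, hP, ha, hconv, hne, hmem, hPue⟩ := exists_blowup_data hJ hT
  have hX : (blowup J T P a hP ha).IsGTree := isGTree_blowup hJt hT.isGTree hconv hne hmem
  obtain ⟨M, hMconv, hMne, hM, hMmin⟩ := exists_minimal_invariant hX
  have hMt := isETree_restrict_blowup hsub hJ.isUE.isETree hT hX hconv hne hMconv hMne
    (isMinimal_restrict hX.isTree hMconv hMne hM hMmin)
  obtain ⟨π, hπ⟩ := exists_projection hX.isTree hMconv hMne
  -- Projecting to `M` first collapses every edge outside `M`, so any edge whose ends have distinct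
  -- images belongs to the `𝓔`-tree.
  let h : (blowup J T P a hP ha).V → T.V := fun z => (π z).1.2
  have hsmul : ∀ (g : G) z, h (g • z) = g • h z := by
    intro g z
    have hg : ∀ x, g • x ∈ M ↔ x ∈ M := fun x =>
      ⟨fun hx => by simpa using hM g⁻¹ _ hx, hM g x⟩
    change (π (g • z)).1.2 = g • (π z).1.2
    rw [hπ.smul hX.isTree.connected hg z]
    rfl
  have hadj : ∀ z w, (blowup J T P a hP ha).graph.Adj z w → h z ≠ h w →
      z ∈ M ∧ w ∈ M ∧ h z = z.1.2 ∧ h w = w.1.2 := by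
    intro z w hzw hne'
    have hzM : z ∈ M ∧ w ∈ M := by
      by_contra hn
      exact hne' (congrArg (fun t => t.1.2) (hπ.eq_of_adj z w hzw hn))
    exact ⟨hzM.1, hzM.2, congrArg (fun t => t.1.2) (hπ.eq_self z hzM.1),
      congrArg (fun t => t.1.2) (hπ.eq_self w hzM.2)⟩
  -- Taking hulls gives convexity at once; `hlift` shows that every edge of `F p` still lifts to `M`
  -- over `p`.
  let F : J.V → Set T.V := fun p => hull T.graph (h '' {z | z.1.1 = p})
  have hlift : ∀ p v w, T.graph.Adj v w → v ∈ F p → w ∈ F p → v ∈ P p ∧ w ∈ P p ∧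
      ∃ z w' : M, z.1.1.1 = p ∧ w'.1.1.1 = p ∧ z.1.1.2 = v ∧ w'.1.1.2 = w := by
    intro p v w hvw hv hw
    obtain ⟨S, hS⟩ := exists_cut hTt.isAcyclic hvw
    obtain ⟨⟨_, ⟨⟨⟨_, v₁⟩, hv₁⟩, rfl, rfl⟩, h1⟩, ⟨_, ⟨⟨⟨p', v₂⟩, hv₂⟩, hp', rfl⟩, h2⟩⟩ :=
      hS.exists_of_mem_hull hv hw
    rename_i p
    obtain rfl : p' = p := hp'
    obtain ⟨c, hc⟩ := (hconv p').exists_walk hTt.connected hv₁ hv₂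
    -- The side is defined for all vertices of `T` by quantifying over proofs of membership in the
    -- fibre.
    obtain ⟨d, hd, hd1, hd2⟩ := c.exists_boundary_dart
      {u | ∀ hu : u ∈ P p', h ⟨(p', u), hu⟩ ∈ S} (fun _ => h1) (fun h' => h2 (h' hv₂))
    have hf := hc _ (c.dart_fst_mem_support_of_mem_darts hd)
    have hs := hc _ (c.dart_snd_mem_support_of_mem_darts hd)
    have hd1 : h ⟨(p', d.fst), hf⟩ ∈ S := hd1 hf
    have hd2 : h ⟨(p', d.snd), hs⟩ ∉ S := fun h' => hd2 fun _ => h'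
    obtain ⟨e1, e2, e3, e4⟩ := hadj ⟨(p', d.fst), hf⟩ ⟨(p', d.snd), hs⟩ (Or.inl ⟨rfl, d.adj⟩)
      (fun h' => hd2 (h' ▸ hd1))
    rw [e3] at hd1
    rw [e4] at hd2
    obtain ⟨i1, i2⟩ := hS.eq _ _ d.adj hd1 hd2
    rw [← i1, ← i2]
    exact ⟨hf, hs, ⟨_, e1⟩, ⟨_, e2⟩, rfl, rfl, rfl, rfl⟩
  have hnue : ∀ p v w, v ∈ F p → w ∈ F p → T.graph.Adj v w → s(v, w) ∉ T.ueEdges 𝓔 𝓗 := by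
    intro p v w hv hw hvw
    obtain ⟨hv', hw', -⟩ := hlift p v w hvw hv hw
    exact hPue p v w hv' hw' hvw
  refine ⟨F, ?_, fun p => isConvex_hull _, ?_, ?_, hnue, ?_, ?_⟩
  · intro g p v hv
    refine smul_mem_hull g ?_ hv
    rintro _ ⟨z, rfl, rfl⟩
    exact ⟨g • z, rfl, hsmul g z⟩
  · intro p
    obtain ⟨v, hv⟩ := hne p
    exact ⟨_, subset_hull _ ⟨⟨(p, v), hv⟩, rfl, rfl⟩⟩
  · intro p q hpq
    let z : (blowup J T P a hP ha).V := ⟨(p, a p q), hmem p q hpq⟩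
    let w : (blowup J T P a hP ha).V := ⟨(q, a q p), hmem q p hpq.symm⟩
    refine ⟨h z, subset_hull _ ⟨z, rfl, rfl⟩, fun g hg => ?_⟩
    obtain ⟨h1, h2⟩ := (hJt.mem_edgeStab hpq).1 hg
    rw [← hsmul, blowup_fixed (z := z) (w := w) hpq rfl h1 h2]
  · intro p q v w hvw hv hw hv' hw'
    obtain ⟨-, -, z₁, z₂, h1, h2, h3, h4⟩ := hlift p v w hvw hv hw
    obtain ⟨-, -, z₁', z₂', h1', h2', h3', h4'⟩ := hlift q v w hvw hv' hw'
    rw [← h1, ← h1']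
    exact eq_of_restrict_blowup (hM := hM) hr hUE hJ.isUE hT hMt hvw (hnue p v w hv hw hvw)
      (h1.trans h2.symm) (h1'.trans h2'.symm) h3 h4 h3' h4'
  · intro v w hvw
    obtain ⟨S, hS⟩ := exists_cut hTt.isAcyclic hvw
    obtain ⟨z₀⟩ := hX.isTree.connected.nonempty
    -- The hull of the image is an invariant subtree, hence all of `T`, so the image of `h` meets
    -- both sides of `vw`.
    have huniv := hTmin (hull T.graph (Set.range h))
      ((isConvex_hull _).induce_connected hTt.connected ⟨_, subset_hull _ ⟨z₀, rfl⟩⟩) (by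
        intro g v hv
        refine smul_mem_hull g ?_ hv
        rintro _ ⟨z, rfl⟩
        exact ⟨g • z, hsmul g z⟩)
    obtain ⟨⟨_, ⟨z₁, rfl⟩, h1⟩, ⟨_, ⟨z₂, rfl⟩, h2⟩⟩ := hS.exists_of_mem_hull
      (huniv ▸ Set.mem_univ v) (huniv ▸ Set.mem_univ w)
    obtain ⟨c⟩ := hX.isTree.connected z₁ z₂
    obtain ⟨d, -, hd1, hd2⟩ := c.exists_boundary_dart {z | h z ∈ S} h1 h2
    obtain ⟨-, -, e3, e4⟩ := hadj d.fst d.snd d.adj fun h' => hd2 (by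
      change h d.snd ∈ S
      rw [← h']
      exact hd1)
    have hdadj := d.adj
    rcases hdadj with ⟨h3, h4⟩ | ⟨h3, h4, h5⟩
    · rw [← e3, ← e4] at h4
      obtain ⟨i1, i2⟩ := hS.eq _ _ h4 hd1 hd2
      rw [← i1, ← i2]
      exact Or.inl ⟨d.fst.1.1, subset_hull _ ⟨_, rfl, rfl⟩, subset_hull _ ⟨_, h3.symm, rfl⟩⟩
    -- The stabilizer of the edge of `J` fixes the two image points, which are separated by `vw`, so
    -- it fixes `v` and `w`.
    · refine Or.inr ⟨_, _, h3, fun g hg => ?_⟩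
      obtain ⟨j1, j2⟩ := (hJt.mem_edgeStab h3).1 hg
      obtain ⟨k1, k2⟩ := hS.fixes hTt hd1 hd2
        (by rw [← hsmul, blowup_fixed h3 h4 j1 j2])
        (by rw [← hsmul, blowup_fixed h3.symm h5 j2 j1])
      exact mem_edgeStab_of_fixed k1 k2

end GGraph

/-! ### Traces of cylinders in an arbitrary `𝓔`-tree -/

namespace GGraph

variable {G : Type u} [Group G] {𝓔 𝓗 : Set (Subgroup G)} {r : Subgroup G → Subgroup G → Prop}

/-- The vertices of the `𝓔`-tree `T` that are fixed by some group of the equivalence class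
defining the cylinder `Y` of `J`. -/
def cylinderTrace (𝓔 : Set (Subgroup G)) (r : Subgroup G → Subgroup G → Prop) (J T : GGraph G)
    (Y : Set (Sym2 J.V)) : Set T.V :=
  {v | ∃ B ∈ 𝓔, T.Fixes B v ∧ ∃ e ∈ Y, r (J.edgeStab e) B}

theorem smul_mem_cylinderTrace (h𝓔 : ∀ A ∈ 𝓔, ∀ g : G, Cylinders.conj g A ∈ 𝓔)
    (hr : IsAdmissible 𝓔 𝓗 r) {J T : GGraph G} (hJ : J.IsETree 𝓔 𝓗) {Y : Set (Sym2 J.V)}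
    (hY : J.IsCylinder r Y) (g : G) {v : T.V} (hv : v ∈ cylinderTrace 𝓔 r J T Y) :
    g • v ∈ cylinderTrace 𝓔 r J T (g • Y) := by
  obtain ⟨B, hB, hfix, e, he, hre⟩ := hv
  refine ⟨_, h𝓔 B hB g, hfix.conj g, g • e, Set.smul_mem_smul_set he, ?_⟩
  rw [edgeStab_smul]
  exact hr.conj _ (hJ.edgeStab_mem e (hY.mem_edges he)) _ hB hre g

theorem rel_of_edgeInSegment_cylinderTrace (hr : IsAdmissible 𝓔 𝓗 r) {J T : GGraph G}
    (hJ : J.IsETree 𝓔 𝓗) (hT : T.IsETree 𝓔 𝓗) {Y : Set (Sym2 J.V)} (hY : J.IsCylinder r Y)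
    {a b : T.V} (ha : a ∈ cylinderTrace 𝓔 r J T Y) (hb : b ∈ cylinderTrace 𝓔 r J T Y)
    {e : Sym2 T.V} (he : T.EdgeInSegment e a b) :
    ∃ e' ∈ Y, r (J.edgeStab e') (T.edgeStab e) := by
  obtain ⟨A, hA, hfixA, e₁, he₁, hr₁⟩ := ha
  obtain ⟨B, hB, hfixB, e₂, he₂, hr₂⟩ := hb
  have h1 := hJ.edgeStab_mem _ (hY.mem_edges he₁)
  have h2 := hJ.edgeStab_mem _ (hY.mem_edges he₂)
  have hE := hT.edgeStab_mem _ (edgeInSegment_mem_edges he)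
  have hAB : r A B := hr.trans _ hA _ h1 _ hB (hr.symm _ h1 _ hA hr₁)
    (hr.trans _ h1 _ h2 _ hB (hY.rel hr hJ he₁ he₂) hr₂)
  exact ⟨e₁, he₁, hr.trans _ h1 _ hA _ hE hr₁
    (hr.symm _ hE _ hA (hr.segment T hT A hA B hB hAB a b hfixA hfixB e he).1)⟩

/-- A vertex of the segment other than its origin is fixed by the stabilizer of an adjacent edge of
the segment, which is in the class by the segment axiom in `T`. -/
theorem isConvex_cylinderTrace (hr : IsAdmissible 𝓔 𝓗 r) {J T : GGraph G}
    (hJ : J.IsETree 𝓔 𝓗) (hT : T.IsETree 𝓔 𝓗) {Y : Set (Sym2 J.V)} (hY : J.IsCylinder r Y) :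
    IsConvex T.graph (cylinderTrace 𝓔 r J T Y) := by
  intro a ha b hb p hp x hx
  rcases exists_edge_of_mem_support p hx with rfl | ⟨e, he, hxe⟩
  · exact ha
  · have hseg : T.EdgeInSegment e a b := ⟨p, hp, he⟩
    have hmem := edgeInSegment_mem_edges hseg
    exact ⟨_, hT.edgeStab_mem e hmem, hT.isGTree.fixes_of_mem hmem hxe,
      rel_of_edgeInSegment_cylinderTrace hr hJ hT hY ha hb hseg⟩

end GGraph

end Cylinders

/-! ### Compatibility of the tree of cylinders -/

open Cylinders Cylinders.GGraph in
theorem mainTheorem8 {G : Type u} [Group G] [Group.FG G]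
    (𝓔 𝓗 : Set (Subgroup G))
    (h𝓔 : ∀ A ∈ 𝓔, ∀ g : G, Cylinders.conj g A ∈ 𝓔)
    (r : Subgroup G → Subgroup G → Prop)
    (hr : Cylinders.IsAdmissible 𝓔 𝓗 r)
    (hsub : Cylinders.IsSubstable 𝓔 𝓗)
    (hUE : Cylinders.PreservesUniversalEllipticity 𝓔 𝓗 r)
    (TJ : Cylinders.GGraph G) (hTJ : Cylinders.IsJSJTree 𝓔 𝓗 TJ) :
    (Cylinders.GGraph.treeOfCylinders hr hTJ.isUE.isETree).IsGTree ∧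
      ∀ T : Cylinders.GGraph G, T.IsETree 𝓔 𝓗 → T.IsMinimal →
        (Cylinders.GGraph.treeOfCylinders hr hTJ.isUE.isETree).Compatible T := by
  have hJ := hTJ.isUE.isETree
  refine ⟨isGTree_treeOfCylinders hr hJ, fun T hT hTmin => ?_⟩
  obtain ⟨F, hF, hconv, hne, hfix, hnue, huniq, hcov⟩ :=
    exists_vertex_family hr hsub hUE hTJ hT hTmin
  -- An edge of `Y` at `x` has a stabilizer fixing a vertex of `F x`, and this vertex lies in the
  -- trace.
  have hFY : ∀ x (Y : V₁ hr hJ), TJ.MemCylinder x Y.1 →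
      (F x ∩ cylinderTrace 𝓔 r TJ T Y.1).Nonempty := by
    rintro x Y ⟨e, he, hxe⟩
    obtain ⟨y, rfl⟩ := Sym2.mem_iff_exists.1 hxe
    have hmem := IsCylinder.mem_edges Y.2 he
    have hE := hJ.edgeStab_mem _ hmem
    obtain ⟨v, hv, hvfix⟩ := hfix x y hmem
    exact ⟨v, hv, _, hE, hvfix, _, he, hr.refl _ hE⟩
  have hYue : ∀ (Y : V₁ hr hJ) v w, T.graph.Adj v w → v ∈ cylinderTrace 𝓔 r TJ T Y.1 →
      w ∈ cylinderTrace 𝓔 r TJ T Y.1 → s(v, w) ∈ T.ueEdges 𝓔 𝓗 := by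
    intro Y v w hvw hv hw
    obtain ⟨e, he, hre⟩ :=
      rel_of_edgeInSegment_cylinderTrace hr hJ hT Y.2 hv hw (edgeInSegment_of_adj hvw)
    have hmem := IsCylinder.mem_edges Y.2 he
    exact ⟨hvw, (hUE _ (hJ.edgeStab_mem _ hmem) _ (hT.edgeStab_mem _ hvw) hre).1
      (hTJ.isUE.edgeStab_ue _ hmem)⟩
  obtain ⟨R, hR, ⟨f, hf⟩, hR'⟩ := exists_blowup_refining (isGTree_fullTreeOfCylinders hr hJ)
    hT.isGTree (fun z : TJ.V ⊕ V₁ hr hJ => Sum.elim F (fun Y => cylinderTrace 𝓔 r TJ T Y.1) z)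
    (by
      rintro g (x | Y) v hv
      · exact hF g x v hv
      · exact smul_mem_cylinderTrace h𝓔 hr hJ Y.2 g hv)
    (by
      rintro (x | Y)
      · exact hconv x
      · exact isConvex_cylinderTrace hr hJ hT Y.2)
    (by
      rintro (x | Y)
      · exact hne x
      · obtain ⟨x, hx⟩ := IsCylinder.exists_memCylinder hr hJ Y.2
        exact (hFY x Y hx).mono Set.inter_subset_right)
    (by
      rintro (x | Y) (x' | Y') h
      · exact h.elim
      · exact hFY x Y' h
      · exact Set.inter_comm _ _ ▸ hFY x' Y h
      · exact h.elim)
    (by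
      intro v w hvw
      rcases hcov v w hvw with ⟨p, hp⟩ | ⟨x, y, hxy, hle⟩
      · exact ⟨Sum.inl p, hp⟩
      · have hE := hT.edgeStab_mem s(v, w) hvw
        have hre := hr.incl _ (hJ.edgeStab_mem s(x, y) hxy) _ hE hle
        have hself := mem_cylinder_self hr hJ (show s(x, y) ∈ TJ.edges from hxy)
        exact ⟨Sum.inr ⟨TJ.cylinder r s(x, y), isCylinder_cylinder hxy⟩,
          ⟨_, hE, hT.isGTree.fixes_of_mem hvw (by simp), _, hself, hre⟩,
          ⟨_, hE, hT.isGTree.fixes_of_mem hvw (by simp), _, hself, hre⟩⟩)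
    -- Vertex subtrees contain no universally elliptic edge and traces contain only such edges; two
    -- traces sharing an edge have the same equivalence class.
    (by
      rintro v w hvw (x | Y) (x' | Y') h1 h2 h3 h4
      · exact congrArg Sum.inl (huniq x x' v w hvw h1 h2 h3 h4)
      · exact absurd (hYue Y' v w hvw h3 h4) (hnue x v w h1 h2 hvw)
      · exact absurd (hYue Y v w hvw h1 h2) (hnue x' v w h3 h4 hvw)
      · obtain ⟨e, he, hre⟩ :=
          rel_of_edgeInSegment_cylinderTrace hr hJ hT Y.2 h1 h2 (edgeInSegment_of_adj hvw)
        obtain ⟨e', he', hre'⟩ :=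
          rel_of_edgeInSegment_cylinderTrace hr hJ hT Y'.2 h3 h4 (edgeInSegment_of_adj hvw)
        have hm := IsCylinder.mem_edges Y.2 he
        have hm' := hJ.edgeStab_mem _ (IsCylinder.mem_edges Y'.2 he')
        have hE := hT.edgeStab_mem s(v, w) hvw
        refine congrArg Sum.inr (Subtype.ext (IsCylinder.eq hr hJ Y.2 Y'.2 he ?_))
        exact IsCylinder.mem_of_rel hr hJ Y'.2 he' hm (hr.trans _ hm' _ hE _
          (hJ.edgeStab_mem _ hm) hre' (hr.symm _ (hJ.edgeStab_mem _ hm) _ hE hre)))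
  obtain ⟨κ, hκ⟩ := fullTreeOfCylinders_refines hr hJ
  exact ⟨R, hR, ⟨_, hκ.comp hf⟩, hR'⟩
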